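/- Let $f:\mathbb R^n\to\mathbb R$ be convex, $\lambda>0$, and let $\phi:\mathbb R^n\times\mathbb R^n\to\mathbb R$ be $\phi$-regular, i.e. $\phi$ is $C^1$; $\phi\ge 0$ and $\phi(z,x)=0\Leftrightarrow z=x$; for some $\beta>0$ and all $z,x,z',x'$, $$\phi(z',x')-\phi(z,x)\ \ge\ \nabla_z\phi(z,x)^T(z'-z)+\nabla_x\phi(z,x)^T(x'-x)+\beta\|(z'-z)-(x'-x)\|^2;$$ for some $L>0$, $\|\nabla\phi(z',x')-\nabla\phi(z,x)\|\le L\|(z'-z)-(x'-x)\|$ always; and $\nabla_z\phi=-\nabla_x\phi$. Put $f_\phi(x)=\min_{z}\{f(z)+\frac1\lambda\phi(z,x)\}$ and $g=\nabla f_\phi$. For all $x$ and $\varepsilon>0$ let $p^a(x,\varepsilon)$ be a given point such that $f^a_\phi(x,\varepsilon):=f(p^a(x,\varepsilon))+\frac1\lambda\phi(p^a(x,\varepsilon),x)\le f_\phi(x)+\varepsilon$, and put $g^a(x,\varepsilon)=\frac1\lambda\nabla_x\phi(p^a(x,\varepsilon),x)$. Algorithm. Let $a,\delta,c_1>0$,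 $\rho\in(0,1)$, let $M\ge1$ be an integer, let $\varphi:[0,\infty)\to[0,\infty)$ be a forcing function ($\varphi(t_i)\to0$ implies $t_i\to0$ for all sequences $t_i\ge 0$), and let $\psi:[0,\infty)\to[0,1)$ be decreasing with $\psi(t)>0$ for $t>0$. Start from any $x^0\in\mathbb R^n$, $\varepsilon_0>0$. At step $k$, stop if $g^a_k:=g^a(x^k,\varepsilon_k)=0$; otherwise choose a symmetric positive semidefinite matrix $V_k$ and $\alpha_k>0$, put $d^k=-(V_k+\alpha_kI)^{-1}g^a_k$, $\gamma_k=\min\{\delta,\ c_1\varphi(-(g^a_k)^Td^k/\|d^k\|)+\psi(\|g^a_k\|)\}$, choose $\varepsilon_{k+1}$ with $0<\varepsilon_{k+1}\le\frac12\varepsilon_k$, and choose an integer $m(k)\ge 0$ with $m(0)=0$ and $m(k)\le\min\{m(k-1)+1,M\}$ for $k\ge1$; let $h_k$ be the least integer $h\ge0$ such that $$f^a_\phi(x^k+\rho^had^k,\varepsilon_{k+1})\le\max_{0\le j\le m(k)}f^a_\phi(x^{k-j},\varepsilon_{k-j})+\gamma_k\rho^ha\,(g^a_k)^Td^k+\varepsilon_k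 ,$$ and set $\tau_k=\rho^{h_k}a$, $x^{k+1}=x^k+\tau_kd^k$. For $x\in\mathbb R^n$ let $\Omega_g$ be the set of points where $g$ is differentiable and $\partial_Bg(x)$ the set of all limits $\lim_i\nabla g(u^i)$ with $u^i\in\Omega_g$, $u^i\to x$; $g$ is BD-regular at $x$ if it is Lipschitz continuous and all elements of $\partial_Bg(x)$ are nonsingular. Theorem. Let $\{x^k\}$ be an infinite sequence generated by the algorithm with $\delta<\frac12$ and $a=1$. Assume that the eigenvalues of all matrices $V_k+\alpha_kI$ lie in one interval $[c,C]$ with $0<c\le C<\infty$; that $\bar x$ minimizes $f$ over $\mathbb R^n$ and $g$ is BD-regular at $\bar x$; that $\varepsilon_k=o(\|g(x^k)\|^2)$, $\operatorname{dist}(V_k,\partial_Bg(x^k))\to0$ and $\alpha_k\to0$; and that $\nabla g$ is Lipschitz near the iterates, i.e. there are $r>0$ and $l$ such that, for all large $k$, $\|\nabla g(u)-\nabla g(v)\|\le l\|u-v\|$ for all $u,v\in\Omega_g$ with $\|u-x^k\|<r$, $\|v-x^k\|<r$. Then $\bar x$ is the unique minimizer of $f$; $\tau_k=1$ for all large $k$;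 and $\{x^k\}$ converges to $\bar x$ two-step Q-superlinearly, i.e. $x^k\to\bar x$ and $\|x^{k+2}-\bar x\|=o(\|x^k-\bar x\|)$. -/

import Mathlib

open Filter Topology Asymptotics

noncomputable section

/-- The Euclidean space `ℝⁿ`. -/
abbrev Rn (n : ℕ) : Type := EuclideanSpace ℝ (Fin n)

/-- Forcing functions `φ : [0,∞) → [0,∞)`; only the values on `[0,∞)` matter. -/
def IsForcing (φ : ℝ → ℝ) : Prop :=
  (∀ t, 0 ≤ t → 0 ≤ φ t) ∧
  ∀ t : ℕ → ℝ, (∀ i, 0 ≤ t i) → Tendsto (fun i => φ (t i)) atTop (𝓝 0) → Tendsto t atTop (𝓝 0)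

/-- Partial gradient in the first variable. -/
def gradFst {n : ℕ} (φ : Rn n → Rn n → ℝ) (z x : Rn n) : Rn n := gradient (fun w => φ w x) z

/-- Partial gradient in the second variable. -/
def gradSnd {n : ℕ} (φ : Rn n → Rn n → ℝ) (z x : Rn n) : Rn n := gradient (fun w => φ z w) x

/-- `φ`-regular functions on `ℝⁿ × ℝⁿ`. -/
structure IsPhiRegular {n : ℕ} (φ : Rn n → Rn n → ℝ) : Prop where
  contDiff : ContDiff ℝ 1 (fun q : Rn n × Rn n => φ q.1 q.2)
  nonneg : ∀ z x, 0 ≤ φ z x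
  eq_zero_iff : ∀ z x, φ z x = 0 ↔ z = x
  strongConvex : ∃ β : ℝ, 0 < β ∧ ∀ z' x' z x : Rn n,
    inner ℝ (gradFst φ z x) (z' - z) + inner ℝ (gradSnd φ z x) (x' - x)
      + β * ‖(z' - z) - (x' - x)‖ ^ 2 ≤ φ z' x' - φ z x
  lipschitz : ∃ L : ℝ, 0 < L ∧ ∀ z' x' z x : Rn n,
    Real.sqrt (‖gradFst φ z' x' - gradFst φ z x‖ ^ 2 + ‖gradSnd φ z' x' - gradSnd φ z x‖ ^ 2)
      ≤ L * ‖(z' - z) - (x' - x)‖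
  grad_antisymm : ∀ z x, gradFst φ z x = - gradSnd φ z x

/-- The `φ`-regularization `f_φ(x) = min_z { f(z) + φ(z,x)/λ }` of `f`. -/
def phiReg {n : ℕ} (f : Rn n → ℝ) (φ : Rn n → Rn n → ℝ) (lam : ℝ) (x : Rn n) : ℝ :=
  ⨅ z, (f z + 1 / lam * φ z x)

/-- The gradient `g = ∇ f_φ`. -/
def phiGrad {n : ℕ} (f : Rn n → ℝ) (φ : Rn n → Rn n → ℝ) (lam : ℝ) (x : Rn n) : Rn n :=
  gradient (phiReg f φ lam) x

/-- The approximate value `f_φᵃ(x,ε) = f(pᵃ(x,ε)) + φ(pᵃ(x,ε),x)/λ`. -/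
def approxVal {n : ℕ} (f : Rn n → ℝ) (φ : Rn n → Rn n → ℝ) (lam : ℝ)
    (pa : Rn n → ℝ → Rn n) (x : Rn n) (ε : ℝ) : ℝ :=
  f (pa x ε) + 1 / lam * φ (pa x ε) x

/-- The approximate gradient `gᵃ(x,ε) = ∇ₓφ(pᵃ(x,ε),x)/λ`. -/
def approxGrad {n : ℕ} (φ : Rn n → Rn n → ℝ) (lam : ℝ)
    (pa : Rn n → ℝ → Rn n) (x : Rn n) (ε : ℝ) : Rn n :=
  (1 / lam) • gradSnd φ (pa x ε) x

/-- `pᵃ(x,ε)` is an `ε`-approximate minimizer of `z ↦ f(z) + φ(z,x)/λ`, for all `x` and `ε > 0`. -/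
def IsApproxProx {n : ℕ} (f : Rn n → ℝ) (φ : Rn n → Rn n → ℝ) (lam : ℝ)
    (pa : Rn n → ℝ → Rn n) : Prop :=
  ∀ x ε, 0 < ε → approxVal f φ lam pa x ε ≤ phiReg f φ lam x + ε

/-- The B-subdifferential `∂_B g(x)`. -/
def bSubdiff {n : ℕ} (g : Rn n → Rn n) (x : Rn n) : Set (Rn n →L[ℝ] Rn n) :=
  {A | ∃ u : ℕ → Rn n, (∀ k, DifferentiableAt ℝ g (u k)) ∧ Tendsto u atTop (𝓝 x) ∧
    Tendsto (fun k => fderiv ℝ g (u k)) atTop (𝓝 A)}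

/-- BD-regularity of `g` at `x`. -/
def IsBDRegular {n : ℕ} (g : Rn n → Rn n) (x : Rn n) : Prop :=
  (∃ K, LipschitzWith K g) ∧ ∀ A ∈ bSubdiff g x, IsUnit A

/-- The constants and auxiliary functions of the generalized Armijo line search. -/
structure GAParams where
  a : ℝ
  δ : ℝ
  ρ : ℝ
  c₁ : ℝ
  M : ℕ
  forc : ℝ → ℝ
  ψ : ℝ → ℝ
  a_pos : 0 < a
  δ_pos : 0 < δ
  ρ_pos : 0 < ρ
  ρ_lt_one : ρ < 1
  c₁_pos : 0 < c₁
  M_pos : 0 < M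
  isForcing : IsForcing forc
  ψ_nonneg : ∀ t, 0 ≤ t → 0 ≤ ψ t
  ψ_lt_one : ∀ t, 0 ≤ t → ψ t < 1
  ψ_anti : AntitoneOn ψ (Set.Ici 0)
  ψ_pos : ∀ t, 0 < t → 0 < ψ t

/-- The factor `min {δ, c₁ φ(-gᵀd/‖d‖) + ψ(‖g‖)}` of the line search. -/
def GAParams.gam {n : ℕ} (P : GAParams) (g d : Rn n) : ℝ :=
  min P.δ (P.c₁ * P.forc (-(inner ℝ g d) / ‖d‖) + P.ψ ‖g‖)

/-- `max_{0 ≤ j ≤ m} F(k - j)`. -/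
def windowMax (F : ℕ → ℝ) (k m : ℕ) : ℝ :=
  (Finset.range (m + 1)).sup' ⟨0, Finset.mem_range.mpr (Nat.succ_pos m)⟩ (fun j => F (k - j))

/-- An infinite run of the algorithm: iterates `x k`, directions `d k`, matrices `V k`, scalars
`α k`, tolerances `ε k`, memory lengths `m k`, line-search exponents `h k`, step lengths `τ k`. -/
structure IsRun {n : ℕ} (f : Rn n → ℝ) (φ : Rn n → Rn n → ℝ) (lam : ℝ)
    (pa : Rn n → ℝ → Rn n) (P : GAParams)
    (x d : ℕ → Rn n) (V : ℕ → (Rn n →L[ℝ] Rn n)) (α ε : ℕ → ℝ) (m h : ℕ → ℕ)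
    (τ : ℕ → ℝ) : Prop where
  ε_pos : ∀ k, 0 < ε k
  ε_succ : ∀ k, ε (k + 1) ≤ 1 / 2 * ε k
  /-- the stopping test never succeeds -/
  grad_ne : ∀ k, approxGrad φ lam pa (x k) (ε k) ≠ 0
  /-- `V k` is symmetric positive semidefinite -/
  V_pos : ∀ k, (V k).IsPositive
  α_pos : ∀ k, 0 < α k
  /-- `d k = - (V k + α k I)⁻¹ gᵃ(x k, ε k)` -/
  direction : ∀ k, (V k + α k • ContinuousLinearMap.id ℝ (Rn n)) (d k)
    = - approxGrad φ lam pa (x k) (ε k)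
  m_zero : m 0 = 0
  m_succ : ∀ k, m (k + 1) ≤ min (m k + 1) P.M
  /-- `h k` is the first exponent that passes the nonmonotone test -/
  h_least : ∀ k, IsLeast {i : ℕ |
    approxVal f φ lam pa (x k + (P.ρ ^ i * P.a) • d k) (ε (k + 1))
      ≤ windowMax (fun j => approxVal f φ lam pa (x j) (ε j)) k (m k)
        + P.gam (approxGrad φ lam pa (x k) (ε k)) (d k) * (P.ρ ^ i * P.a)
            * inner ℝ (approxGrad φ lam pa (x k) (ε k)) (d k)
        + ε k} (h k)
  τ_eq : ∀ k, τ k = P.ρ ^ h k * P.a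
  x_succ : ∀ k, x (k + 1) = x k + τ k • d k

/-- All eigenvalues of the matrices `B k` lie in one compact interval of `(0,∞)`. -/
def EigenvaluesUnifBdd {n : ℕ} (B : ℕ → (Rn n →L[ℝ] Rn n)) : Prop :=
  ∃ c C : ℝ, 0 < c ∧ ∀ (k : ℕ) (μ : ℝ),
    Module.End.HasEigenvalue (B k : Rn n →ₗ[ℝ] Rn n) μ → c ≤ μ ∧ μ ≤ C

/-- `∇g`, where it exists, is Lipschitz near the points `x k`, with a common constant and on balls
of a common radius, for all large `k`. -/
def DerivLipschitzNear {n : ℕ} (g : Rn n → Rn n) (x : ℕ → Rn n) : Prop :=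
  ∃ r l : ℝ, 0 < r ∧ ∀ᶠ k in atTop, ∀ u ∈ Metric.ball (x k) r, ∀ v ∈ Metric.ball (x k) r,
    DifferentiableAt ℝ g u → DifferentiableAt ℝ g v →
      ‖fderiv ℝ g u - fderiv ℝ g v‖ ≤ l * ‖u - v‖

/-- `x k → xbar` with `‖x (k+2) - xbar‖ = o(‖x k - xbar‖)`. -/
def ConvergesTwoStepQSuperlinearly {n : ℕ} (x : ℕ → Rn n) (xbar : Rn n) : Prop :=
  Tendsto x atTop (𝓝 xbar) ∧
    (fun k => ‖x (k + 2) - xbar‖) =o[atTop] (fun k => ‖x k - xbar‖)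

end

/-! The relation between the partial gradients makes `φ z x` depend on `z - x` only, so `f_φ` is an
infimal convolution of `f` with a strongly convex kernel. It is therefore convex with Lipschitz
gradient `g`, an `ε`-minimizer yields `g` up to `O(√ε)`, and minimizers of `f` are zeros of `g`
(`phiReg_facts`, `phiGrad_eq_zero`).

Derivatives of `g` are symmetric positive semidefinite. BD-regularity and compactness make them
uniformly positive definite near `xbar`; a mean value inequality for Lipschitz maps and monotonicity
turn this into a global error bound (`exists_error_bound`). The bound gives uniqueness and reduces
`x k → xbar` to `g (x k) → 0`.

For the latter, adding `2 ε k` to the approximate values absorbs the tolerances and leaves an exact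
nonmonotone descent. The steps `τ k` stay away from zero, so the guaranteed decrease dominates a
multiple of `‖g (x k)‖²`. In each late block of `M + 1` indices one decrease is small, and `‖g (x
k)‖` grows by at most a fixed factor per step, so the whole sequence tends to zero
(`IsRun.tendsto_gradient`).

The Lipschitz condition on `∇g` near the iterates forces `∇g` to have a single limit `B` at `xbar`.
The matrices `V k + α k I` then tend to `B`, and `x k + d k` is asymptotically a Newton step with
error `o(‖x k - xbar‖)`. With `e = x k - xbar`, the unit step decreases `f_φ` by about `⟨B e, e⟩ /
2`, while the test asks for at most about `δ ⟨B e, e⟩`; hence `δ < 1/2` makes `τ k = 1`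
(`IsRun.eventually_unit_step`). This gives one-step superlinear convergence, hence the two-step
statement. -/

/-! ### The regularizing function as a kernel in `z - x`. -/

section PhiRegular

variable {n : ℕ} {φ : Rn n → Rn n → ℝ}

/-- Under a common shift the linear terms cancel and the quadratic term vanishes in the strong
convexity inequality; the shift by `-s` gives the reverse inequality. -/
theorem IsPhiRegular.add_right (hφ : IsPhiRegular φ) (z x s : Rn n) :
    φ (z + s) (x + s) = φ z x := by
  obtain ⟨β, -, hsc⟩ := hφ.strongConvex
  have key : ∀ z x s : Rn n, φ z x ≤ φ (z + s) (x + s) := by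
    intro z x s
    have h := hsc (z + s) (x + s) z x
    rw [hφ.grad_antisymm] at h
    simp at h
    exact h
  refine le_antisymm ?_ (key z x s)
  have h := key (z + s) (x + s) (-s)
  simpa using h

theorem IsPhiRegular.eq_sub_zero (hφ : IsPhiRegular φ) (z x : Rn n) : φ z x = φ (z - x) 0 := by
  have h := hφ.add_right (z - x) 0 x
  simpa using h

theorem IsPhiRegular.gradFst_eq (hφ : IsPhiRegular φ) (z x : Rn n) :
    gradFst φ z x = gradFst φ (z - x) 0 := by
  obtain ⟨L, -, hL⟩ := hφ.lipschitz
  have h := hL z x (z - x) 0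
  simp only [sub_zero, sub_sub_cancel, sub_self, norm_zero, mul_zero] at h
  have h2 := Real.sqrt_eq_zero'.1 (le_antisymm h (Real.sqrt_nonneg _))
  have h3 : ‖gradFst φ z x - gradFst φ (z - x) 0‖ ^ 2 = 0 :=
    le_antisymm (by nlinarith [sq_nonneg ‖gradSnd φ z x - gradSnd φ (z - x) 0‖]) (sq_nonneg _)
  simpa [sub_eq_zero] using h3

theorem IsPhiRegular.gradSnd_eq (hφ : IsPhiRegular φ) (z x : Rn n) :
    gradSnd φ z x = -gradFst φ (z - x) 0 := by
  rw [← hφ.gradFst_eq, hφ.grad_antisymm, neg_neg]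

theorem IsPhiRegular.norm_gradFst_sub_le (hφ : IsPhiRegular φ) :
    ∃ L : ℝ, 0 < L ∧ ∀ u v : Rn n, ‖gradFst φ u 0 - gradFst φ v 0‖ ≤ L * ‖u - v‖ := by
  obtain ⟨L, hL0, hL⟩ := hφ.lipschitz
  refine ⟨L, hL0, fun u v => ?_⟩
  have h := hL u 0 v 0
  simp only [sub_zero] at h
  refine le_trans (Real.le_sqrt_of_sq_le ?_) h
  nlinarith [sq_nonneg ‖gradSnd φ u 0 - gradSnd φ v 0‖]

theorem IsPhiRegular.sub_zero_strongConvex (hφ : IsPhiRegular φ) :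
    ∃ β : ℝ, 0 < β ∧ ∀ u v : Rn n,
      φ v 0 + inner ℝ (gradFst φ v 0) (u - v) + β * ‖u - v‖ ^ 2 ≤ φ u 0 := by
  obtain ⟨β, hβ, hsc⟩ := hφ.strongConvex
  refine ⟨β, hβ, fun u v => ?_⟩
  have h := hsc u 0 v 0
  simp at h
  linarith

theorem IsPhiRegular.gradFst_zero (hφ : IsPhiRegular φ) : gradFst φ (0 : Rn n) 0 = 0 := by
  have hmin : IsLocalMin (fun w => φ w 0) 0 := Eventually.of_forall fun w => by
    have := (hφ.eq_zero_iff 0 0).2 rfl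
    simpa [this] using hφ.nonneg w 0
  have := hmin.fderiv_eq_zero
  simp [gradFst, gradient, this]

theorem IsPhiRegular.continuous (hφ : IsPhiRegular φ) (x : Rn n) : Continuous (fun z => φ z x) :=
  hφ.contDiff.continuous.comp (by fun_prop : Continuous fun z : Rn n => (z, x))

end PhiRegular

/-! ### Smoothness and convexity of the regularization. -/

section Moreau

variable {n : ℕ} {f : Rn n → ℝ} {φ : Rn n → Rn n → ℝ} {lam : ℝ}

/-- The kernel has zero gradient at the origin, hence grows quadratically; since `f` is bounded
below, the objective is coercive. -/
theorem exists_prox (hf : ConvexOn ℝ Set.univ f) (hφ : IsPhiRegular φ) (hlam : 0 < lam)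
    {xbar : Rn n} (hmin : ∀ y, f xbar ≤ f y) (x : Rn n) :
    ∃ p, ∀ z, f p + 1 / lam * φ p x ≤ f z + 1 / lam * φ z x := by
  obtain ⟨β, hβ, hsc⟩ := hφ.sub_zero_strongConvex
  have hc : Continuous fun z => f z + 1 / lam * φ z x := by
    have h1 : Continuous f := continuousOn_univ.1 (hf.continuousOn isOpen_univ)
    have h2 := hφ.continuous x
    fun_prop
  refine hc.exists_forall_le ?_
  have hlow : ∀ z, f xbar + 1 / lam * (β * ‖z - x‖ ^ 2) ≤ f z + 1 / lam * φ z x := by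
    intro z
    have h := hsc (z - x) 0
    rw [hφ.gradFst_zero, (hφ.eq_zero_iff 0 0).2 rfl] at h
    simp only [inner_zero_left, sub_zero, zero_add] at h
    rw [hφ.eq_sub_zero z x]
    have := hmin z
    gcongr
  refine tendsto_atTop_mono hlow (tendsto_atTop_add_const_left _ _ ?_)
  refine Tendsto.const_mul_atTop (by positivity) (Tendsto.const_mul_atTop hβ ?_)
  refine (tendsto_pow_atTop two_ne_zero).comp ?_
  have h1 : Tendsto (fun z : Rn n => ‖z‖ - ‖x‖) (cocompact _) atTop :=
    tendsto_atTop_add_const_right _ _ tendsto_norm_cocompact_atTop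
  exact tendsto_atTop_mono (fun z => norm_sub_norm_le z x) h1

/-- Optimality of `p` read as a subgradient inequality for `f`: compare `p` with `p + t (z - p)`,
divide by `t` and let `t → 0`. -/
theorem prox_variational (hf : ConvexOn ℝ Set.univ f) (hφ : IsPhiRegular φ) (hlam : 0 < lam)
    {x p : Rn n} (hp : ∀ z, f p + 1 / lam * φ p x ≤ f z + 1 / lam * φ z x) (z : Rn n) :
    f p - 1 / lam * inner ℝ (gradFst φ (p - x) 0) (z - p) ≤ f z := by
  obtain ⟨β, hβ, hsc⟩ := hφ.sub_zero_strongConvex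
  obtain ⟨L, hL0, hL⟩ := hφ.norm_gradFst_sub_le
  set v := z - p with hv
  have key : ∀ t : ℝ, 0 < t → t ≤ 1 →
      f p - 1 / lam * inner ℝ (gradFst φ (p - x) 0) v ≤ f z + t * (1 / lam * (L * ‖v‖ ^ 2)) := by
    intro t ht ht1
    have hcv := hf.2 (Set.mem_univ p) (Set.mem_univ z) (by linarith : 0 ≤ 1 - t) ht.le (by ring)
    have hpt : (1 - t) • p + t • z = p + t • v := by rw [hv]; module
    rw [hpt, smul_eq_mul, smul_eq_mul] at hcv
    have h1 := hp (p + t • v)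
    rw [hφ.eq_sub_zero p x, hφ.eq_sub_zero (p + t • v) x] at h1
    have h2 := hsc (p - x) (p + t • v - x)
    have e1 : p - x - (p + t • v - x) = -(t • v) := by module
    rw [e1, inner_neg_right, inner_smul_right, norm_neg] at h2
    have h3 : inner ℝ (gradFst φ (p + t • v - x) 0) v
        ≤ inner ℝ (gradFst φ (p - x) 0) v + t * (L * ‖v‖ ^ 2) := by
      have h4 := real_inner_le_norm (gradFst φ (p + t • v - x) 0 - gradFst φ (p - x) 0) v
      have h5 := hL (p + t • v - x) (p - x)
      have e2 : p + t • v - x - (p - x) = t • v := by module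
      rw [e2, norm_smul, Real.norm_of_nonneg ht.le] at h5
      rw [inner_sub_left] at h4
      nlinarith [mul_le_mul_of_nonneg_right h5 (norm_nonneg v)]
    have h6 : φ (p + t • v - x) 0 - φ (p - x) 0
        ≤ t * (inner ℝ (gradFst φ (p - x) 0) v + t * (L * ‖v‖ ^ 2)) := by
      nlinarith [mul_le_mul_of_nonneg_left h3 ht.le, sq_nonneg ‖t • v‖]
    have h7 : 1 / lam * (φ (p + t • v - x) 0 - φ (p - x) 0)
        ≤ 1 / lam * (t * (inner ℝ (gradFst φ (p - x) 0) v + t * (L * ‖v‖ ^ 2))) :=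
      mul_le_mul_of_nonneg_left h6 (by positivity)
    have h8 : t * (f p - 1 / lam * inner ℝ (gradFst φ (p - x) 0) v)
        ≤ t * (f z + t * (1 / lam * (L * ‖v‖ ^ 2))) := by
      nlinarith
    exact le_of_mul_le_mul_left h8 ht
  have hlim : Tendsto (fun t : ℝ => f z + t * (1 / lam * (L * ‖v‖ ^ 2))) (𝓝[>] 0)
      (𝓝 (f z + 0 * (1 / lam * (L * ‖v‖ ^ 2)))) := by
    refine Tendsto.mono_left (Continuous.tendsto ?_ 0) nhdsWithin_le_nhds
    fun_prop
  rw [zero_mul, add_zero] at hlim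
  refine ge_of_tendsto hlim ?_
  filter_upwards [Ioc_mem_nhdsGT (zero_lt_one' ℝ)] with t ht using key t ht.1 ht.2

theorem phiReg_bddBelow (hφ : IsPhiRegular φ) (hlam : 0 < lam)
    {xbar : Rn n} (hmin : ∀ y, f xbar ≤ f y) (x : Rn n) :
    BddBelow (Set.range fun z => f z + 1 / lam * φ z x) := by
  refine ⟨f xbar, ?_⟩
  rintro _ ⟨z, rfl⟩
  have := mul_nonneg (by positivity : 0 ≤ 1 / lam) (hφ.nonneg z x)
  have := hmin z
  simp only
  linarith

theorem phiReg_eq (hφ : IsPhiRegular φ) (hlam : 0 < lam)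
    {xbar : Rn n} (hmin : ∀ y, f xbar ≤ f y)
    {x p : Rn n} (hp : ∀ z, f p + 1 / lam * φ p x ≤ f z + 1 / lam * φ z x) :
    phiReg f φ lam x = f p + 1 / lam * φ p x :=
  le_antisymm (ciInf_le (phiReg_bddBelow hφ hlam hmin x) p) (le_ciInf hp)

theorem hasGradientAt_of_quadratic_bound {F : Rn n → ℝ} {v x : Rn n} {K : ℝ}
    (h1 : ∀ y, F x + inner ℝ v (y - x) ≤ F y)
    (h2 : ∀ y, F y ≤ F x + inner ℝ v (y - x) + K * ‖y - x‖ ^ 2) : HasGradientAt F v x := by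
  rw [hasGradientAt_iff_isLittleO]
  refine IsBigO.trans_isLittleO (g := fun y => ‖y - x‖ ^ 2) ?_ ?_
  · refine IsBigO.of_bound K (Eventually.of_forall fun y => ?_)
    rw [Real.norm_of_nonneg (by linarith [h1 y]), Real.norm_of_nonneg (sq_nonneg _)]
    linarith [h2 y]
  · have h := (isLittleO_pow_sub_sub (E' := Rn n) x (m := 2) (by norm_num))
    exact h

/-- The regularization is convex and smooth, its gradient is Lipschitz, and approximate minimizers
give approximate gradients. -/
theorem phiReg_facts (hf : ConvexOn ℝ Set.univ f) (hφ : IsPhiRegular φ) (hlam : 0 < lam)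
    {xbar : Rn n} (hmin : ∀ y, f xbar ≤ f y) :
    ∃ K c : ℝ, 0 < K ∧ 0 < c ∧
      (∀ x, HasGradientAt (phiReg f φ lam) (phiGrad f φ lam x) x) ∧
      (∀ x y, phiReg f φ lam x + inner ℝ (phiGrad f φ lam x) (y - x) ≤ phiReg f φ lam y) ∧
      (∀ x y, phiReg f φ lam y ≤ phiReg f φ lam x + inner ℝ (phiGrad f φ lam x) (y - x)
        + K * ‖y - x‖ ^ 2) ∧
      (∀ x y, ‖phiGrad f φ lam x - phiGrad f φ lam y‖ ≤ K * ‖x - y‖) ∧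
      (∀ q x ε, 0 < ε → f q + 1 / lam * φ q x ≤ phiReg f φ lam x + ε →
        ‖(1 / lam) • gradSnd φ q x - phiGrad f φ lam x‖ ≤ c * Real.sqrt ε) := by
  obtain ⟨β, hβ, hsc⟩ := hφ.sub_zero_strongConvex
  obtain ⟨L, hL0, hL⟩ := hφ.norm_gradFst_sub_le
  choose p hp using exists_prox hf hφ hlam hmin
  have hval : ∀ x, phiReg f φ lam x = f (p x) + 1 / lam * φ (p x) x :=
    fun x => phiReg_eq hφ hlam hmin (hp x)
  set G : Rn n → Rn n := fun x => -((1 / lam) • gradFst φ (p x - x) 0) with hG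
  have hil : 0 < 1 / lam := by positivity
  -- The subgradient inequality for `f` plus strong convexity of the kernel. Taking `z = p y` gives
  -- convexity with a surplus; taking `y = x` bounds the error of an approximate minimizer.
  have hlow : ∀ x z y, phiReg f φ lam x + inner ℝ (G x) (y - x)
      + 1 / lam * β * ‖(z - y) - (p x - x)‖ ^ 2 ≤ f z + 1 / lam * φ z y := by
    intro x z y
    rw [hval x, hφ.eq_sub_zero z y, hφ.eq_sub_zero (p x) x]
    have h1 := prox_variational hf hφ hlam (hp x) z
    have h2 := mul_le_mul_of_nonneg_left (hsc (z - y) (p x - x)) hil.le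
    have e : y - x = (z - p x) - ((z - y) - (p x - x)) := by abel
    have e2 : inner ℝ (G x) (y - x) = - (1 / lam * inner ℝ (gradFst φ (p x - x) 0) (z - p x))
        + 1 / lam * inner ℝ (gradFst φ (p x - x) 0) ((z - y) - (p x - x)) := by
      rw [e, hG]
      simp only [inner_neg_left, inner_smul_left, inner_sub_right]
      simp
      ring
    rw [e2]
    linarith
  have hGL : ∀ x z y, ‖-((1 / lam) • gradFst φ (z - y) 0) - G x‖
      ≤ 1 / lam * (L * ‖(z - y) - (p x - x)‖) := by
    intro x z y
    have e : -((1 / lam) • gradFst φ (z - y) 0) - G x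
        = -((1 / lam) • (gradFst φ (z - y) 0 - gradFst φ (p x - x) 0)) := by
      rw [hG]; module
    rw [e, norm_neg, norm_smul, Real.norm_of_nonneg hil.le]
    exact mul_le_mul_of_nonneg_left (hL _ _) hil.le
  have hlow' : ∀ x y, phiReg f φ lam x + inner ℝ (G x) (y - x)
      + 1 / lam * β * ‖(p y - y) - (p x - x)‖ ^ 2 ≤ phiReg f φ lam y := by
    intro x y
    have := hlow x (p y) y
    rwa [← hval y] at this
  -- Adding `hlow'` for `(x, y)` and `(y, x)` bounds the squared kernel displacement by `‖G x - G y‖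
  -- ‖x - y‖`, while `‖G x - G y‖` is at most `L / lam` times the displacement.
  set K : ℝ := L ^ 2 / (lam * β) with hK
  have hK0 : 0 < K := by positivity
  have hlip : ∀ x y, ‖G x - G y‖ ≤ K * ‖x - y‖ := by
    intro x y
    have h1 := hlow' x y
    have h2 := hlow' y x
    have h3 := hGL y (p x) x
    have e1 : ‖(p y - y) - (p x - x)‖ = ‖(p x - x) - (p y - y)‖ := norm_sub_rev _ _
    rw [e1] at h1
    set q := ‖(p x - x) - (p y - y)‖
    change ‖G x - G y‖ ≤ 1 / lam * (L * q) at h3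
    have e2 : inner ℝ (G x) (y - x) = - inner ℝ (G x) (x - y) := by
      rw [← inner_neg_right, neg_sub]
    have h4 := real_inner_le_norm (G x - G y) (x - y)
    rw [inner_sub_left] at h4
    have h5 : 2 * (1 / lam * β * q ^ 2) ≤ ‖G x - G y‖ * ‖x - y‖ := by linarith
    have h6 : ‖G x - G y‖ ^ 2 ≤ K * (1 / lam * β * q ^ 2) := by
      have e3 : K * (1 / lam * β * q ^ 2) = (1 / lam * (L * q)) ^ 2 := by
        rw [hK]; field_simp
      rw [e3]
      exact pow_le_pow_left₀ (norm_nonneg _) h3 2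
    have h7 : 0 ≤ 1 / lam * β * q ^ 2 := by positivity
    by_contra hcon
    push Not at hcon
    have hpos : 0 < ‖G x - G y‖ := lt_of_le_of_lt (by positivity) hcon
    nlinarith
  have hsub : ∀ x y, phiReg f φ lam x + inner ℝ (G x) (y - x) ≤ phiReg f φ lam y := by
    intro x y
    have := hlow' x y
    have h7 : 0 ≤ 1 / lam * β * ‖(p y - y) - (p x - x)‖ ^ 2 := by positivity
    linarith
  have hup : ∀ x y, phiReg f φ lam y ≤ phiReg f φ lam x + inner ℝ (G x) (y - x)
      + K * ‖y - x‖ ^ 2 := by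
    intro x y
    have h1 := hsub y x
    have e2 : inner ℝ (G y) (x - y) = - inner ℝ (G y) (y - x) := by
      rw [← inner_neg_right, neg_sub]
    have h4 := real_inner_le_norm (G y - G x) (y - x)
    rw [inner_sub_left] at h4
    have h5 := mul_le_mul_of_nonneg_right (hlip y x) (norm_nonneg (y - x))
    nlinarith
  have hgrad : ∀ x, HasGradientAt (phiReg f φ lam) (G x) x :=
    fun x => hasGradientAt_of_quadratic_bound (hsub x) (hup x)
  have hGeq : phiGrad f φ lam = G := funext fun x => (hgrad x).gradient
  rw [hGeq]
  refine ⟨K, 1 / lam * (L * (Real.sqrt (lam / β))), hK0, by positivity, hgrad, hsub, hup, hlip, ?_⟩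
  intro q x ε hε hq
  rw [hφ.gradSnd_eq, smul_neg]
  refine (hGL x q x).trans ?_
  have h1 := hlow x q x
  simp only [sub_self, inner_zero_right, add_zero] at h1
  have h2 : ‖(q - x) - (p x - x)‖ ^ 2 ≤ lam / β * ε := by
    have h3 : 1 / lam * β * ‖(q - x) - (p x - x)‖ ^ 2 ≤ ε := by linarith
    have e : ‖(q - x) - (p x - x)‖ ^ 2
      = lam / β * (1 / lam * β * ‖(q - x) - (p x - x)‖ ^ 2) := by field_simp
    rw [e]
    exact mul_le_mul_of_nonneg_left h3 (by positivity)
  have h4 : ‖(q - x) - (p x - x)‖ ≤ Real.sqrt (lam / β) * Real.sqrt ε := by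
    rw [← Real.sqrt_mul (by positivity)]
    exact Real.le_sqrt_of_sq_le h2
  calc 1 / lam * (L * ‖(q - x) - (p x - x)‖)
      ≤ 1 / lam * (L * (Real.sqrt (lam / β) * Real.sqrt ε)) := by gcongr
    _ = _ := by ring

theorem phiReg_le (hφ : IsPhiRegular φ) (hlam : 0 < lam)
    {xbar : Rn n} (hmin : ∀ y, f xbar ≤ f y) (x z : Rn n) :
    phiReg f φ lam x ≤ f z + 1 / lam * φ z x :=
  ciInf_le (phiReg_bddBelow hφ hlam hmin x) z

theorem phiReg_min (hφ : IsPhiRegular φ) (hlam : 0 < lam)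
    {xbar : Rn n} (hmin : ∀ y, f xbar ≤ f y) (y : Rn n) :
    phiReg f φ lam xbar ≤ phiReg f φ lam y := by
  have h1 := phiReg_le hφ hlam hmin xbar xbar
  rw [(hφ.eq_zero_iff xbar xbar).2 rfl, mul_zero, add_zero] at h1
  refine h1.trans (le_ciInf fun z => ?_)
  have := mul_nonneg (by positivity : 0 ≤ 1 / lam) (hφ.nonneg z y)
  linarith [hmin z]

theorem phiGrad_eq_zero (hφ : IsPhiRegular φ) (hlam : 0 < lam)
    {xbar : Rn n} (hmin : ∀ y, f xbar ≤ f y) : phiGrad f φ lam xbar = 0 := by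
  have hloc : IsLocalMin (phiReg f φ lam) xbar :=
    Eventually.of_forall (phiReg_min hφ hlam hmin)
  simp [phiGrad, gradient, hloc.fderiv_eq_zero]

end Moreau

/-! ### Mean value inequalities for Lipschitz maps. -/

section MeanValue

open MeasureTheory

theorem LipschitzWith.le_sub_of_ae_le_deriv {u : ℝ → ℝ} {C : NNReal} (hu : LipschitzWith C u)
    {m : ℝ} (h : ∀ᵐ t : ℝ, t ∈ Set.Icc (0 : ℝ) 1 → m ≤ deriv u t) : m ≤ u 1 - u 0 := by
  have hac : AbsolutelyContinuousOnInterval u 0 1 :=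
    (hu.lipschitzOnWith (s := Set.uIcc 0 1)).absolutelyContinuousOnInterval
  rw [← hac.integral_deriv_eq_sub]
  have h1 : ∫ _ in (0 : ℝ)..1, m ≤ ∫ t in (0 : ℝ)..1, deriv u t := by
    refine intervalIntegral.integral_mono_ae_restrict zero_le_one (by simp)
      hac.intervalIntegrable_deriv ?_
    exact (ae_restrict_iff' measurableSet_Icc).2 h
  simpa using h1

variable {E : Type*} [NormedAddCommGroup E] [InnerProductSpace ℝ E] [FiniteDimensional ℝ E]

/-- Rademacher's theorem and Fubini: for almost every `z`, the line through `z` meets the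
nondifferentiability set in a null set. -/
theorem LipschitzWith.dense_ae_differentiableAt_line {g : E → E} {C : NNReal}
    (hg : LipschitzWith C g) (v : E) :
    Dense {z : E | ∀ᵐ t : ℝ, DifferentiableAt ℝ g (z + t • v)} := by
  borelize E
  obtain ⟨μ, hμ⟩ : ∃ μ : Measure E, μ.IsAddHaarMeasure := ⟨Measure.addHaar, inferInstance⟩
  set S : Set (ℝ × E) := {p | DifferentiableAt ℝ g (p.2 + p.1 • v)} with hS
  have hmeas : MeasurableSet S :=
    (measurableSet_of_differentiableAt ℝ g).preimage
      (f := fun p : ℝ × E => p.2 + p.1 • v) (by fun_prop)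
  have h1 : ∀ᵐ p : ℝ × E ∂(volume.prod μ), p ∈ S := by
    refine (Measure.ae_prod_mem_iff_ae_ae_mem hmeas).2 (Eventually.of_forall fun t => ?_)
    exact (measurePreserving_add_right μ (t • v)).quasiMeasurePreserving.ae
      (hg.ae_differentiableAt (μ := μ))
  have h2 : ∀ᵐ p : E × ℝ ∂(μ.prod volume), p.swap ∈ S :=
    (Measure.measurePreserving_swap (μ := μ) (ν := (volume : Measure ℝ))).quasiMeasurePreserving.ae
      h1
  exact Measure.dense_of_ae (Measure.ae_ae_of_ae_prod h2)

theorem LipschitzWith.dense_differentiableAt {g : E → E} {C : NNReal}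
    (hg : LipschitzWith C g) : Dense {z : E | DifferentiableAt ℝ g z} := by
  borelize E
  exact Measure.dense_of_ae (hg.ae_differentiableAt (μ := (Measure.addHaar : Measure E)))

/-- A mean value inequality for Lipschitz maps, with a bound on the derivative required only where
it exists. -/
theorem LipschitzWith.le_inner_sub_of_le_inner_fderiv {g : E → E} {C : NNReal}
    (hg : LipschitzWith C g) {U : Set E} (hU : IsOpen U) (hUc : Convex ℝ U) {w v z : E} {m : ℝ}
    (hz : z ∈ U) (hzv : z + v ∈ U)
    (h : ∀ y ∈ U, DifferentiableAt ℝ g y → m ≤ inner ℝ w (fderiv ℝ g y v)) :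
    m ≤ inner ℝ w (g (z + v) - g z) := by
  set W : Set E := U ∩ (fun y => y + v) ⁻¹' U with hW
  have hWo : IsOpen W := hU.inter (hU.preimage (by fun_prop))
  -- The given segment may consist of nondifferentiability points. The inequality is proved on
  -- nearby good lines and passes to the limit by continuity.
  have hsub := (hg.dense_ae_differentiableAt_line v).open_subset_closure_inter hWo ⟨hz, hzv⟩
  have hgc := hg.continuous
  have hclosed : IsClosed {y : E | m ≤ inner ℝ w (g (y + v) - g y)} :=
    isClosed_le continuous_const (by fun_prop)
  refine closure_minimal ?_ hclosed hsub
  rintro y ⟨⟨hy, hyv⟩, hae⟩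
  have hlip : ∃ D : NNReal, LipschitzWith D (fun t : ℝ => inner ℝ w (g (y + t • v))) := by
    refine ⟨‖w‖₊ * (C * ‖v‖₊), LipschitzWith.of_dist_le_mul fun s t => ?_⟩
    rw [Real.dist_eq, ← inner_sub_right]
    refine (abs_real_inner_le_norm _ _).trans ?_
    have h1 := hg.dist_le_mul (y + s • v) (y + t • v)
    rw [dist_eq_norm, dist_add_left, dist_eq_norm, ← sub_smul, norm_smul] at h1
    rw [Real.dist_eq]
    simp only [NNReal.coe_mul, coe_nnnorm]
    calc ‖w‖ * ‖g (y + s • v) - g (y + t • v)‖ ≤ ‖w‖ * (C * (‖s - t‖ * ‖v‖)) := by gcongr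
      _ = ‖w‖ * (C * ‖v‖) * |s - t| := by rw [Real.norm_eq_abs]; ring
  obtain ⟨D, hD⟩ := hlip
  have key := hD.le_sub_of_ae_le_deriv (m := m) (by
    filter_upwards [hae] with t ht htI
    have hmem : y + t • v ∈ U := by
      have := hUc.add_smul_sub_mem hy hyv htI
      simpa using this
    have h1 : HasDerivAt (fun t : ℝ => y + t • v) v t := by
      simpa using ((hasDerivAt_id t).smul_const v).const_add y
    have h2 := (ht.hasFDerivAt.comp_hasDerivAt t h1)
    have h3 : HasDerivAt (fun t : ℝ => inner ℝ w (g (y + t • v)))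
        (inner ℝ w (fderiv ℝ g (y + t • v) v)) t := by
      simpa using (hasDerivAt_const t w).inner ℝ h2
    rw [h3.deriv]
    exact h _ hmem ht)
  simpa [inner_sub_right] using key

/-- The scalar inequality is tested against minus the residual itself, which bounds the square of
its norm. -/
theorem LipschitzWith.norm_sub_sub_le_of_fderiv_near {g : E → E} {C : NNReal}
    (hg : LipschitzWith C g) {U : Set E} (hU : IsOpen U) (hUc : Convex ℝ U) {B : E →L[ℝ] E}
    {r : ℝ} (h : ∀ y ∈ U, DifferentiableAt ℝ g y → ‖fderiv ℝ g y - B‖ ≤ r)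
    {y z : E} (hy : y ∈ U) (hz : z ∈ U) : ‖g y - g z - B (y - z)‖ ≤ r * ‖y - z‖ := by
  set e := g y - g z - B (y - z) with he
  have key := hg.le_inner_sub_of_le_inner_fderiv hU hUc (w := -e) (v := y - z) (z := z)
    (m := inner ℝ (-e) (B (y - z)) - ‖e‖ * (r * ‖y - z‖)) hz (by simpa using hy) (by
      intro u hu hd
      have h1 := (fderiv ℝ g u - B).le_of_opNorm_le (h u hu hd) (y - z)
      have h2 := real_inner_le_norm e ((fderiv ℝ g u - B) (y - z))
      have h3 := mul_le_mul_of_nonneg_left h1 (norm_nonneg e)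
      rw [sub_apply, inner_sub_right] at h2
      rw [sub_apply] at h3
      simp only [inner_neg_left]
      linarith)
  rw [add_sub_cancel] at key
  have h4 : inner ℝ (-e) (g y - g z) - inner ℝ (-e) (B (y - z)) = -(‖e‖ * ‖e‖) := by
    rw [← inner_sub_right, ← he, inner_neg_left, real_inner_self_eq_norm_mul_norm]
  have h5 : ‖e‖ * ‖e‖ ≤ ‖e‖ * (r * ‖y - z‖) := by linarith
  rcases (norm_nonneg e).eq_or_lt with h0 | h0
  · have hx : 0 ≤ r * ‖y - z‖ := by
      obtain ⟨u, huU, hud⟩ := hg.dense_differentiableAt.inter_open_nonempty U hU ⟨y, hy⟩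
      exact mul_nonneg ((norm_nonneg _).trans (h u huU hud)) (norm_nonneg _)
    rwa [← h0]
  · exact le_of_mul_le_mul_left h5 h0

end MeanValue

/-! ### Derivatives of a monotone gradient map and the error bound. -/

section ConvexGradient

variable {n : ℕ} {F : Rn n → ℝ} {g : Rn n → Rn n}

theorem inner_fderiv_symm (hF : ∀ x, HasGradientAt F (g x) x) {u : Rn n}
    (hu : DifferentiableAt ℝ g u) (v w : Rn n) :
    inner ℝ (fderiv ℝ g u v) w = inner ℝ v (fderiv ℝ g u w) := by
  have h1 : HasFDerivAt (fun y => innerSL ℝ (g y)) ((innerSL ℝ).comp (fderiv ℝ g u)) u :=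
    (innerSL ℝ : Rn n →L[ℝ] _).hasFDerivAt.comp u hu.hasFDerivAt
  have h2 : ∀ y, HasFDerivAt F (innerSL ℝ (g y)) y := fun y => (hF y).hasFDerivAt
  have h3 := second_derivative_symmetric h2 h1 v w
  simp only [ContinuousLinearMap.comp_apply, innerSL_apply_apply] at h3
  rw [h3, real_inner_comm]

theorem inner_fderiv_nonneg (hmono : ∀ x y, 0 ≤ inner ℝ (g x - g y) (x - y)) {u : Rn n}
    (hu : DifferentiableAt ℝ g u) (v : Rn n) : 0 ≤ inner ℝ (fderiv ℝ g u v) v := by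
  have h1 : HasDerivAt (fun t : ℝ => u + t • v) v 0 := by
    simpa using ((hasDerivAt_id (0 : ℝ)).smul_const v).const_add u
  have hu' : HasFDerivAt g (fderiv ℝ g u) (u + (0 : ℝ) • v) := by simpa using hu.hasFDerivAt
  have h2 := hu'.comp_hasDerivAt (0 : ℝ) h1
  have h3 : HasDerivAt (fun t : ℝ => inner ℝ (g (u + t • v)) v)
      (inner ℝ (fderiv ℝ g u v) v) 0 := by
    simpa using h2.inner ℝ (hasDerivAt_const (0 : ℝ) v)
  rw [← h3.deriv]
  refine Monotone.deriv_nonneg (fun s t hst => ?_)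
  rcases hst.eq_or_lt with rfl | hlt
  · exact le_rfl
  have h4 := hmono (u + t • v) (u + s • v)
  have e : u + t • v - (u + s • v) = (t - s) • v := by module
  rw [e, inner_smul_right, inner_sub_left] at h4
  have := nonneg_of_mul_nonneg_right h4 (sub_pos.2 hlt)
  change inner ℝ (g (u + s • v)) v ≤ inner ℝ (g (u + t • v)) v
  linarith

theorem apply_eq_zero_of_inner_eq_zero {E : Type*} [NormedAddCommGroup E] [InnerProductSpace ℝ E]
    {A : E →L[ℝ] E} (hs : ∀ v w, inner ℝ (A v) w = inner ℝ v (A w))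
    (hp : ∀ v, 0 ≤ inner ℝ (A v) v) {v : E} (hv : inner ℝ (A v) v ≤ 0) : A v = 0 := by
  have h0 : inner ℝ (A v) v = 0 := le_antisymm hv (hp v)
  by_contra hne
  have hpos : 0 < ‖A v‖ ^ 2 := by positivity
  set b := inner ℝ (A (A v)) (A v) with hb
  have key : ∀ t : ℝ, 0 ≤ 2 * t * ‖A v‖ ^ 2 + t ^ 2 * b := by
    intro t
    have h := hp (v + t • A v)
    simp only [map_add, map_smul, inner_add_left, inner_add_right, inner_smul_left,
      inner_smul_right, h0, real_inner_self_eq_norm_sq, hs (A v) v, ← hb] at h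
    simp at h
    linarith
  have hb0 : 0 ≤ b := hp _
  -- Nearly the minimizer of the quadratic in `t`; `b + 1` replaces `b`, which may vanish.
  have := key (-(‖A v‖ ^ 2 / (b + 1)))
  have h1 : (0:ℝ) < b + 1 := by linarith
  have e : 2 * -(‖A v‖ ^ 2 / (b + 1)) * ‖A v‖ ^ 2 + (-(‖A v‖ ^ 2 / (b + 1))) ^ 2 * b
      = -(‖A v‖ ^ 2) ^ 2 * (b + 2) / (b + 1) ^ 2 := by field_simp; ring
  rw [e] at this
  have h2 : 0 < (‖A v‖ ^ 2) ^ 2 * (b + 2) / (b + 1) ^ 2 := by positivity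
  rw [neg_mul, neg_div] at this
  linarith

theorem bSubdiff_nonempty {K : NNReal} (hlip : LipschitzWith K g) (x : Rn n) :
    (bSubdiff g x).Nonempty := by
  have : ProperSpace (Rn n →L[ℝ] Rn n) := FiniteDimensional.proper ℝ _
  obtain ⟨u, hu, hux⟩ := mem_closure_iff_seq_limit.1 (hlip.dense_differentiableAt x)
  obtain ⟨A, -, s, hs, hA⟩ := (isCompact_closedBall (0 : Rn n →L[ℝ] Rn n) K).tendsto_subseq
    (x := fun k => fderiv ℝ g (u k))
    (fun k => by simpa using norm_fderiv_le_of_lipschitz ℝ hlip (x₀ := u k))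
  exact ⟨A, u ∘ s, fun k => hu _, hux.comp hs.tendsto_atTop, hA⟩

/-- Near a BD-regular point the derivatives of a monotone gradient map are uniformly positive
definite. -/
theorem exists_le_inner_fderiv (hF : ∀ x, HasGradientAt F (g x) x)
    (hmono : ∀ x y, 0 ≤ inner ℝ (g x - g y) (x - y)) {K : NNReal} (hlip : LipschitzWith K g)
    {xbar : Rn n} (hBD : ∀ A ∈ bSubdiff g xbar, IsUnit A) :
    ∃ μ > 0, ∀ u ∈ Metric.ball xbar μ, DifferentiableAt ℝ g u →
      ∀ v, μ * ‖v‖ ^ 2 ≤ inner ℝ v (fderiv ℝ g u v) := by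
  by_contra! hcon
  have : ProperSpace (Rn n →L[ℝ] Rn n) := FiniteDimensional.proper ℝ _
  -- Normalized violators subconverge to some `A` in the B-subdifferential and a unit `w` with `⟨A
  -- w, w⟩ ≤ 0`. As `A` is positive semidefinite, `A w = 0`, against regularity.
  choose! u hu hd v hv using fun i : ℕ => hcon (1 / ((i : ℝ) + 1)) (by positivity)
  have hv0 : ∀ i, v i ≠ 0 := by
    intro i h0
    have := hv i
    simp [h0] at this
  set y : ℕ → Rn n := fun i => ‖v i‖⁻¹ • v i with hy
  have hy1 : ∀ i, ‖y i‖ = 1 := fun i => by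
    rw [hy]; simp only [norm_smul, norm_inv, norm_norm]
    exact inv_mul_cancel₀ (norm_ne_zero_iff.2 (hv0 i))
  have hyq : ∀ i, inner ℝ (y i) (fderiv ℝ g (u i) (y i)) ≤ 1 / ((i : ℝ) + 1) := by
    intro i
    have h1 : 0 < ‖v i‖ := norm_pos_iff.2 (hv0 i)
    rw [hy]
    simp only [map_smul, inner_smul_left, inner_smul_right]
    simp only [map_inv₀, conj_trivial]
    rw [← mul_assoc, ← mul_inv, ← pow_two, inv_mul_le_iff₀ (by positivity), mul_comm]
    exact (hv i).le
  obtain ⟨⟨A, w⟩, ⟨-, hw⟩, s, hs, hlim⟩ :=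
    ((isCompact_closedBall (0 : Rn n →L[ℝ] Rn n) K).prod (isCompact_sphere (0 : Rn n) 1)).tendsto_subseq
    (x := fun k => (fderiv ℝ g (u k), y k))
    (fun k => ⟨by simpa using norm_fderiv_le_of_lipschitz ℝ hlip (x₀ := u k), by simpa using hy1 k⟩)
  have hA : Tendsto (fun k => fderiv ℝ g (u (s k))) atTop (𝓝 A) :=
    (continuous_fst.tendsto _).comp hlim
  have hyw : Tendsto (fun k => y (s k)) atTop (𝓝 w) := (continuous_snd.tendsto _).comp hlim
  have hux : Tendsto u atTop (𝓝 xbar) := by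
    rw [tendsto_iff_dist_tendsto_zero]
    exact squeeze_zero (fun _ => dist_nonneg) (fun i => (Metric.mem_ball.1 (hu i)).le)
      tendsto_one_div_add_atTop_nhds_zero_nat
  have hAmem : A ∈ bSubdiff g xbar := ⟨u ∘ s, fun k => hd _, hux.comp hs.tendsto_atTop, hA⟩
  have happly : Tendsto (fun k => fderiv ℝ g (u (s k)) (y (s k))) atTop (𝓝 (A w)) :=
    (isBoundedBilinearMap_apply.continuous.tendsto (A, w)).comp (hA.prodMk_nhds hyw)
  have happ : ∀ a : Rn n, Tendsto (fun k => fderiv ℝ g (u (s k)) a) atTop (𝓝 (A a)) :=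
    fun a =>
      (isBoundedBilinearMap_apply.continuous.tendsto (A, a)).comp (hA.prodMk_nhds tendsto_const_nhds)
  have hsymm : ∀ a b, inner ℝ (A a) b = inner ℝ a (A b) := fun a b =>
    tendsto_nhds_unique ((happ a).inner tendsto_const_nhds)
      ((tendsto_const_nhds.inner (happ b)).congr fun k => (inner_fderiv_symm hF (hd _) a b).symm)
  have hpsd : ∀ a, 0 ≤ inner ℝ (A a) a := fun a =>
    ge_of_tendsto' ((happ a).inner tendsto_const_nhds) fun k => inner_fderiv_nonneg hmono (hd _) a
  have hle : inner ℝ (A w) w ≤ 0 := by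
    rw [hsymm]
    refine le_of_tendsto_of_tendsto' (hyw.inner happly)
      (tendsto_one_div_add_atTop_nhds_zero_nat.comp hs.tendsto_atTop) fun k => hyq (s k)
  have hAw := apply_eq_zero_of_inner_eq_zero hsymm hpsd hle
  obtain ⟨B, hB⟩ := (hBD A hAmem).exists_left_inv
  have hw0 : w = 0 := by
    have : (B * A) w = w := by rw [hB]; rfl
    rw [← this, mul_apply_eq_comp, hAw, map_zero]
  simp [hw0] at hw

/-- A monotone gradient map with a zero at a BD-regular point has a global error bound. -/
theorem exists_error_bound (hF : ∀ x, HasGradientAt F (g x) x)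
    (hmono : ∀ x y, 0 ≤ inner ℝ (g x - g y) (x - y)) {K : NNReal} (hlip : LipschitzWith K g)
    {xbar : Rn n} (hBD : ∀ A ∈ bSubdiff g xbar, IsUnit A) (h0 : g xbar = 0) :
    ∃ μ > 0, (∀ u ∈ Metric.ball xbar μ, DifferentiableAt ℝ g u →
      ∀ v, μ * ‖v‖ ^ 2 ≤ inner ℝ v (fderiv ℝ g u v)) ∧
      ∀ x, μ * min (μ / 2) ‖x - xbar‖ ≤ ‖g x‖ := by
  obtain ⟨μ, hμ, hpd⟩ := exists_le_inner_fderiv hF hmono hlip hBD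
  have hloc : ∀ x ∈ Metric.ball xbar μ, μ * ‖x - xbar‖ ^ 2 ≤ inner ℝ (g x) (x - xbar) := by
    intro x hx
    have := hlip.le_inner_sub_of_le_inner_fderiv Metric.isOpen_ball (convex_ball xbar μ)
      (w := x - xbar) (v := x - xbar) (z := xbar) (Metric.mem_ball_self hμ) (by simpa using hx)
      (fun u hu hd => hpd u hu hd (x - xbar))
    rwa [add_sub_cancel, h0, sub_zero, real_inner_comm] at this
  have hcs : ∀ x, x ≠ xbar → ∀ q : ℝ, q * ‖x - xbar‖ ≤ inner ℝ (g x) (x - xbar) → q ≤ ‖g x‖ := by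
    intro x hx q hq
    have hpos : 0 < ‖x - xbar‖ := norm_pos_iff.2 (sub_ne_zero.2 hx)
    exact le_of_mul_le_mul_right (hq.trans (real_inner_le_norm _ _)) hpos
  refine ⟨μ, hμ, hpd, fun x => ?_⟩
  rcases eq_or_ne x xbar with rfl | hne
  · simp [min_eq_right (half_pos hμ).le, h0]
  have hpos : 0 < ‖x - xbar‖ := norm_pos_iff.2 (sub_ne_zero.2 hne)
  refine hcs x hne _ ?_
  rcases lt_or_ge ‖x - xbar‖ (μ / 2) with hlt | hge
  · rw [min_eq_right hlt.le]
    have := hloc x (by rw [mem_ball_iff_norm]; linarith)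
    nlinarith
  · rw [min_eq_left hge]
    -- Far from `xbar`, the local estimate is used where the segment to `x` meets the sphere of
    -- radius `μ / 2`; monotonicity carries it outward to `x`.
    set t := μ / 2 / ‖x - xbar‖ with ht
    have ht0 : 0 < t := by positivity
    have ht1 : t ≤ 1 := by rw [ht, div_le_one hpos]; exact hge
    have htn : t * ‖x - xbar‖ = μ / 2 := by rw [ht]; field_simp
    set y := xbar + t • (x - xbar) with hy
    have hyx : y - xbar = t • (x - xbar) := by rw [hy]; abel
    have hyn : ‖y - xbar‖ = μ / 2 := by
      rw [hyx, norm_smul, Real.norm_of_nonneg ht0.le, htn]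
    have h1 := hloc y (by rw [mem_ball_iff_norm, hyn]; linarith)
    rw [hyn, hyx, inner_smul_right] at h1
    have h2 : inner ℝ (g y) (x - xbar) ≤ inner ℝ (g x) (x - xbar) := by
      have h3 := hmono x y
      have e : x - y = (1 - t) • (x - xbar) := by rw [hy]; module
      rw [e, inner_smul_right, inner_sub_left] at h3
      rcases ht1.eq_or_lt with h | h
      · have : y = x := by rw [hy, h]; simp
        rw [this]
      · have := nonneg_of_mul_nonneg_right h3 (sub_pos.2 h)
        linarith
    have h4 : t * (μ * (μ / 2) * ‖x - xbar‖) ≤ t * inner ℝ (g x) (x - xbar) := by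
      calc t * (μ * (μ / 2) * ‖x - xbar‖) = μ * (μ / 2) * (t * ‖x - xbar‖) := by ring
        _ = μ * (μ / 2) ^ 2 := by rw [htn]; ring
        _ ≤ _ := h1.trans (mul_le_mul_of_nonneg_left h2 ht0.le)
    exact le_of_mul_le_mul_left h4 ht0

end ConvexGradient

/-! ### Nonmonotone descent over sliding windows. -/

section Window

theorem le_windowMax (F : ℕ → ℝ) (k : ℕ) {m j : ℕ} (hj : j ≤ m) : F (k - j) ≤ windowMax F k m :=
  Finset.le_sup' (fun j => F (k - j)) (Finset.mem_range.2 (Nat.lt_succ_of_le hj))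

theorem windowMax_le {F : ℕ → ℝ} {k m : ℕ} {b : ℝ} (h : ∀ j ≤ m, F (k - j) ≤ b) :
    windowMax F k m ≤ b :=
  Finset.sup'_le _ _ fun j hj => h j (Nat.le_of_lt_succ (Finset.mem_range.1 hj))

variable {Φ s : ℕ → ℝ} {m : ℕ → ℕ} {M : ℕ}

theorem windowMax_antitone (hm : ∀ k, m (k + 1) ≤ min (m k + 1) M) (hs : ∀ k, 0 ≤ s k)
    (hstep : ∀ k, Φ (k + 1) ≤ windowMax Φ k (m k) - s k) :
    Antitone fun k => windowMax Φ k (m k) := by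
  refine antitone_nat_of_succ_le fun k => windowMax_le fun j hj => ?_
  rcases j with _ | i
  · have := hs k
    have := hstep k
    simp only [Nat.sub_zero]
    linarith
  · have hi : i ≤ m k := by have := hm k; omega
    rw [Nat.add_sub_add_right]
    exact le_windowMax Φ k hi

theorem le_first_of_nonmonotone (hm : ∀ k, m (k + 1) ≤ min (m k + 1) M)
    (hs : ∀ k, 0 ≤ s k) (hstep : ∀ k, Φ (k + 1) ≤ windowMax Φ k (m k) - s k) (k : ℕ) :
    Φ k ≤ Φ 0 := by
  have h1 := le_windowMax Φ k (Nat.zero_le (m k))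
  have h2 := windowMax_antitone hm hs hstep (Nat.zero_le k)
  -- Truncated subtraction: `0 - j = 0`.
  have h3 : windowMax Φ 0 (m 0) ≤ Φ 0 := windowMax_le fun j _ => by simp
  exact h1.trans (h2.trans h3)

/-- In a nonmonotone descent scheme that is bounded below, each window of indices contains
an arbitrarily small decrease. -/
theorem eventually_exists_lt_of_nonmonotone (hm : ∀ k, m (k + 1) ≤ min (m k + 1) M)
    (hs : ∀ k, 0 ≤ s k) (hstep : ∀ k, Φ (k + 1) ≤ windowMax Φ k (m k) - s k)
    {b : ℝ} (hb : ∀ k, b ≤ Φ k) {η : ℝ} (hη : 0 < η) :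
    ∀ᶠ k in atTop, ∃ j, k ≤ j ∧ j ≤ k + M ∧ s j < η := by
  have hanti := windowMax_antitone hm hs hstep
  set U : ℕ → ℝ := fun k => windowMax Φ k (m k) with hU
  have hbdd : BddBelow (Set.range U) := by
    refine ⟨b, ?_⟩
    rintro _ ⟨k, rfl⟩
    exact (hb k).trans (le_windowMax Φ k (Nat.zero_le (m k)))
  have hlim := tendsto_atTop_ciInf hanti hbdd
  have hdiff : Tendsto (fun k => U k - U (k + (M + 1))) atTop (𝓝 0) := by
    have := hlim.sub (hlim.comp (tendsto_add_atTop_nat (M + 1)))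
    simpa using this
  filter_upwards [hdiff.eventually_lt_const hη] with k hk
  by_contra! hcon
  -- Every entry of the window at `k + M + 1` was produced by a step with index in `[k, k + M]`, so
  -- it lies at least `η` below `U k`.
  have : U (k + (M + 1)) ≤ U k - η := by
    refine windowMax_le fun j hj => ?_
    have hjM : j ≤ M := by
      have h1 : m (k + M + 1) ≤ min (m (k + M) + 1) M := hm (k + M)
      have h2 : j ≤ m (k + M + 1) := hj
      omega
    have e : k + (M + 1) - j = (k + M - j) + 1 := by omega
    rw [e]
    have h1 := hstep (k + M - j)
    have h2 := hcon (k + M - j) (by omega) (by omega)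
    have h3 : U (k + M - j) ≤ U k := hanti (by omega)
    change Φ (k + M - j + 1) ≤ U (k + M - j) - s (k + M - j) at h1
    linarith
  linarith

theorem tendsto_zero_of_window {a : ℕ → ℝ} {Q : ℝ} (ha : ∀ k, 0 ≤ a k) (hQ : 1 ≤ Q)
    (hstep : ∀ᶠ k in atTop, a (k + 1) ≤ Q * a k)
    (hwin : ∀ η > 0, ∀ᶠ k in atTop, ∃ j, k ≤ j ∧ j ≤ k + M ∧ a j < η) :
    Tendsto a atTop (𝓝 0) := by
  obtain ⟨N, hN⟩ := eventually_atTop.1 hstep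
  have hQ0 : 0 < Q := by linarith
  have hprop : ∀ i j, N ≤ j → a (j + i) ≤ Q ^ i * a j := by
    intro i j hj
    induction i with
    | zero => simp
    | succ i ih =>
      have h1 := hN (j + i) (by omega)
      calc a (j + (i + 1)) ≤ Q * a (j + i) := h1
        _ ≤ Q * (Q ^ i * a j) := by gcongr
        _ = Q ^ (i + 1) * a j := by ring
  rw [Metric.tendsto_atTop]
  intro η hη
  obtain ⟨N', hN'⟩ := eventually_atTop.1 (hwin (η / Q ^ M) (by positivity))
  refine ⟨N + N' + M, fun k hk => ?_⟩
  obtain ⟨j, hj1, hj2, hj⟩ := hN' (k - M) (by omega)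
  have h1 := hprop (k - j) j (by omega)
  rw [Nat.add_sub_cancel' (by omega)] at h1
  rw [Real.dist_eq, sub_zero, abs_of_nonneg (ha k)]
  have h2 : Q ^ (k - j) ≤ Q ^ M := pow_le_pow_right₀ hQ (by omega)
  calc a k ≤ Q ^ (k - j) * a j := h1
    _ ≤ Q ^ M * a j := mul_le_mul_of_nonneg_right h2 (ha j)
    _ < Q ^ M * (η / Q ^ M) := by gcongr
    _ = η := by field_simp

end Window

/-! ### Bounds from eigenvalues. -/

section Spectral

variable {E : Type*} [NormedAddCommGroup E] [InnerProductSpace ℝ E] [FiniteDimensional ℝ E]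

/-- Expansion in an orthonormal eigenbasis. In dimension zero there are no eigenvalues and `C` may
be negative, hence `max C 1`. -/
theorem LinearMap.IsSymmetric.bounds_of_eigenvalues {T : E →ₗ[ℝ] E} (hT : T.IsSymmetric)
    {c C : ℝ} (hc : 0 < c) (h : ∀ μ, Module.End.HasEigenvalue T μ → c ≤ μ ∧ μ ≤ C) (v : E) :
    c * ‖v‖ ^ 2 ≤ inner ℝ (T v) v ∧ ‖T v‖ ≤ max C 1 * ‖v‖ := by
  set b := hT.eigenvectorBasis rfl with hb
  set l := hT.eigenvalues rfl with hl
  have hev : ∀ i, c ≤ l i ∧ l i ≤ C := fun i => h _ (hT.hasEigenvalue_eigenvalues rfl i)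
  have hcoord : ∀ i, inner ℝ (b i) (T v) = l i * inner ℝ (b i) v := by
    intro i
    rw [← hT (b i) v, hb, hT.apply_eigenvectorBasis rfl i, inner_smul_left]
    simp [hl]
  have hn : ∀ w : E, ‖w‖ ^ 2 = ∑ i, inner ℝ (b i) w ^ 2 := by
    intro w
    rw [← b.sum_sq_norm_inner_right w]
    simp
  constructor
  · rw [← b.sum_inner_mul_inner (T v) v, hn v, Finset.mul_sum]
    refine Finset.sum_le_sum fun i _ => ?_
    rw [real_inner_comm (b i) (T v), hcoord]
    nlinarith [sq_nonneg (inner ℝ (b i) v), (hev i).1]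
  · refine le_of_sq_le_sq ?_ (by positivity)
    rw [mul_pow, hn (T v), hn v, Finset.mul_sum]
    refine Finset.sum_le_sum fun i _ => ?_
    rw [hcoord, mul_pow]
    have h1 : l i ≤ max C 1 := (hev i).2.trans (le_max_left _ _)
    have h2 : 0 ≤ l i := hc.le.trans (hev i).1
    gcongr

end Spectral

/-! ### Gradient estimates. -/

section Descent

variable {n : ℕ} {F : Rn n → ℝ} {g : Rn n → Rn n} {K : ℝ}

/-- A gradient step of length `1 / (2 K)` cannot go below the minimum. -/
theorem sq_norm_gradient_le (hK : 0 < K)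
    (hup : ∀ x y, F y ≤ F x + inner ℝ (g x) (y - x) + K * ‖y - x‖ ^ 2)
    {xbar : Rn n} (hmin : ∀ y, F xbar ≤ F y) (x : Rn n) : ‖g x‖ ^ 2 ≤ 4 * K * (F x - F xbar) := by
  have h1 := hup x (x - (1 / (2 * K)) • g x)
  have h2 := hmin (x - (1 / (2 * K)) • g x)
  have e : x - (1 / (2 * K)) • g x - x = -((1 / (2 * K)) • g x) := by abel
  rw [e, inner_neg_right, inner_smul_right, real_inner_self_eq_norm_sq, norm_neg, norm_smul,
    Real.norm_of_nonneg (by positivity : 0 ≤ 1 / (2 * K)), mul_pow] at h1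
  have h3 : F xbar ≤ F x - 1 / (4 * K) * ‖g x‖ ^ 2 := by
    calc F xbar ≤ _ := h2.trans h1
      _ = _ := by field_simp; ring
  have h4 : 4 * K * (1 / (4 * K) * ‖g x‖ ^ 2) = ‖g x‖ ^ 2 := by field_simp
  have h5 : 4 * K * (1 / (4 * K) * ‖g x‖ ^ 2) ≤ 4 * K * (F x - F xbar) :=
    mul_le_mul_of_nonneg_left (by linarith) (by positivity)
  linarith

theorem eventually_norm_sub_le_of_isLittleO {E : Type*} [NormedAddCommGroup E] {u v : ℕ → E}
    {ε : ℕ → ℝ} {c : ℝ} (hc : 0 < c)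
    (huv : ∀ k, ‖u k - v k‖ ≤ c * Real.sqrt (ε k)) (hε : ε =o[atTop] fun k => ‖v k‖ ^ 2)
    {η : ℝ} (hη : 0 < η) : ∀ᶠ k in atTop, ‖u k - v k‖ ≤ η * ‖v k‖ := by
  filter_upwards [hε.bound (c := (η / c) ^ 2) (by positivity)] with k hk
  have h1 : Real.sqrt (ε k) ≤ η / c * ‖v k‖ := by
    refine Real.sqrt_le_iff.2 ⟨by positivity, ?_⟩
    rw [Real.norm_eq_abs, norm_pow, norm_norm] at hk
    calc ε k ≤ |ε k| := le_abs_self _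
      _ ≤ _ := hk
      _ = _ := by ring
  calc ‖u k - v k‖ ≤ c * Real.sqrt (ε k) := huv k
    _ ≤ c * (η / c * ‖v k‖) := by gcongr
    _ = η * ‖v k‖ := by field_simp

end Descent

/-! ### Global convergence of the gradients. -/

section Run

variable {n : ℕ} {f : Rn n → ℝ} {φ : Rn n → Rn n → ℝ} {lam : ℝ} {pa : Rn n → ℝ → Rn n}
  {P : GAParams} {x d : ℕ → Rn n} {V : ℕ → (Rn n →L[ℝ] Rn n)} {α ε : ℕ → ℝ} {m h : ℕ → ℕ}
  {τ : ℕ → ℝ}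

theorem IsRun.direction_bounds (hrun : IsRun f φ lam pa P x d V α ε m h τ)
    (heig : EigenvaluesUnifBdd (fun k => V k + α k • ContinuousLinearMap.id ℝ (Rn n))) :
    ∃ c C : ℝ, 0 < c ∧ 0 < C ∧
      (∀ k v, c * ‖v‖ ≤ ‖(V k + α k • ContinuousLinearMap.id ℝ (Rn n)) v‖) ∧
      ∀ k, c * ‖d k‖ ^ 2 ≤ -inner ℝ (approxGrad φ lam pa (x k) (ε k)) (d k) ∧
        ‖approxGrad φ lam pa (x k) (ε k)‖ ≤ C * ‖d k‖ := by
  obtain ⟨c, C, hc, hev⟩ := heig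
  set B := fun k => V k + α k • ContinuousLinearMap.id ℝ (Rn n) with hB
  have hsymm : ∀ k, (B k : Rn n →ₗ[ℝ] Rn n).IsSymmetric := by
    intro k a b
    have h1 : inner ℝ (V k a) b = inner ℝ a (V k b) := (hrun.V_pos k).isSymmetric a b
    change inner ℝ (V k a + α k • a) b = inner ℝ a (V k b + α k • b)
    rw [inner_add_left, inner_add_right, real_inner_smul_left, real_inner_smul_right, h1]
  have hb : ∀ k v, c * ‖v‖ ^ 2 ≤ inner ℝ (B k v) v ∧ ‖B k v‖ ≤ max C 1 * ‖v‖ := fun k v =>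
    (hsymm k).bounds_of_eigenvalues hc (hev k) v
  refine ⟨c, max C 1, hc, by positivity, fun k v => ?_, fun k => ?_⟩
  · have h1 := (hb k v).1.trans (real_inner_le_norm _ _)
    rcases (norm_nonneg v).eq_or_lt with h0 | h0
    · rw [← h0]; simp
    · rw [pow_two, ← mul_assoc] at h1
      exact le_of_mul_le_mul_right h1 h0
  · have h1 := hb k (d k)
    rw [show B k (d k) = -approxGrad φ lam pa (x k) (ε k) from hrun.direction k, inner_neg_left, norm_neg] at h1
    exact h1

theorem IsRun.ε_antitone (hrun : IsRun f φ lam pa P x d V α ε m h τ) : Antitone ε :=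
  antitone_nat_of_succ_le fun k => by linarith [hrun.ε_succ k, hrun.ε_pos k]

theorem GAParams.gam_nonneg (P : GAParams) {g d : Rn n} (hgd : 0 ≤ -inner ℝ g d) :
    0 ≤ P.gam g d := by
  refine le_min P.δ_pos.le (add_nonneg (mul_nonneg P.c₁_pos.le (P.isForcing.1 _ ?_))
    (P.ψ_nonneg _ (norm_nonneg _)))
  positivity

theorem GAParams.le_gam (P : GAParams) {g d : Rn n} (hgd : 0 ≤ -inner ℝ g d) {b : ℝ}
    (hb : ‖g‖ ≤ b) : min P.δ (P.ψ b) ≤ P.gam g d := by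
  refine min_le_min le_rfl ?_
  have h1 := P.ψ_anti (Set.mem_Ici.2 (norm_nonneg g))
    (Set.mem_Ici.2 ((norm_nonneg g).trans hb)) hb
  have h2 : 0 ≤ P.c₁ * P.forc (-inner ℝ g d / ‖d‖) :=
    mul_nonneg P.c₁_pos.le (P.isForcing.1 _ (by positivity))
  linarith

/-- The values `f_φᵃ(x k, ε k) + 2 ε k` satisfy an exact nonmonotone descent inequality. -/
theorem IsRun.nonmonotone_step (hrun : IsRun f φ lam pa P x d V α ε m h τ) (k : ℕ) :
    approxVal f φ lam pa (x (k + 1)) (ε (k + 1)) + 2 * ε (k + 1) ≤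
      windowMax (fun j => approxVal f φ lam pa (x j) (ε j) + 2 * ε j) k (m k)
        - P.gam (approxGrad φ lam pa (x k) (ε k)) (d k) * τ k *
          -inner ℝ (approxGrad φ lam pa (x k) (ε k)) (d k) := by
  have h1 := (hrun.h_least k).1
  rw [Set.mem_ofPred_eq] at h1
  rw [← hrun.τ_eq k, ← hrun.x_succ k] at h1
  -- The weight `2` fits the halving: `ε k + 2 * ε (k + 1) ≤ 2 * ε k`, and older tolerances are
  -- larger.
  have h2 : windowMax (fun j => approxVal f φ lam pa (x j) (ε j)) k (m k) + 2 * ε k ≤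
      windowMax (fun j => approxVal f φ lam pa (x j) (ε j) + 2 * ε j) k (m k) := by
    rw [← le_sub_iff_add_le]
    refine windowMax_le fun j hj => ?_
    have h3 := le_windowMax (fun j => approxVal f φ lam pa (x j) (ε j) + 2 * ε j) k hj
    have h4 := hrun.ε_antitone (Nat.sub_le k j)
    linarith
  have h3 := hrun.ε_succ k
  linarith

theorem IsRun.τ_pos (hrun : IsRun f φ lam pa P x d V α ε m h τ) (k : ℕ) : 0 < τ k := by
  rw [hrun.τ_eq]; exact mul_pos (pow_pos P.ρ_pos _) P.a_pos

theorem IsRun.τ_le_one (hrun : IsRun f φ lam pa P x d V α ε m h τ) (ha : P.a = 1) (k : ℕ) :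
    τ k ≤ 1 := by
  rw [hrun.τ_eq, ha, mul_one]; exact pow_le_one₀ P.ρ_pos.le P.ρ_lt_one.le

theorem IsRun.d_ne_zero (hrun : IsRun f φ lam pa P x d V α ε m h τ) (k : ℕ) : d k ≠ 0 := by
  intro h0
  have h1 := hrun.direction k
  rw [h0, map_zero] at h1
  exact hrun.grad_ne k (neg_eq_zero.1 h1.symm)

variable {F : Rn n → ℝ} {g : Rn n → Rn n} {K : ℝ}

/-- If the preceding trial step `t` failed, the quadratic upper bound on `F` gives `q / 4 ≤ K t ‖d
k‖²` with `q = -γᵀd ≥ c ‖d k‖²`, so `t ≥ c / (4 K)`. The `1/4` is the gap between the slope `3/4`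
kept by the true gradient and the bound `1/2` on the line search factor. -/
theorem IsRun.eventually_le_τ (hrun : IsRun f φ lam pa P x d V α ε m h τ) (hK : 0 < K)
    (hδ : P.δ < 1 / 2) (ha : P.a = 1)
    (hup : ∀ x y, F y ≤ F x + inner ℝ (g x) (y - x) + K * ‖y - x‖ ^ 2)
    (hlo : ∀ y e, 0 < e → F y ≤ approxVal f φ lam pa y e)
    (hpa : ∀ y e, 0 < e → approxVal f φ lam pa y e ≤ F y + e)
    {c C : ℝ} (hc : 0 < c) (hC : 0 < C)
    (hdir : ∀ k, c * ‖d k‖ ^ 2 ≤ -inner ℝ (approxGrad φ lam pa (x k) (ε k)) (d k) ∧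
        ‖approxGrad φ lam pa (x k) (ε k)‖ ≤ C * ‖d k‖)
    (hga : ∀ η > 0, ∀ᶠ k in atTop,
      ‖approxGrad φ lam pa (x k) (ε k) - g (x k)‖ ≤ η * ‖g (x k)‖) :
    ∃ τ₀ > 0, ∀ᶠ k in atTop, τ₀ ≤ τ k := by
  have hρ := P.ρ_pos
  refine ⟨min 1 (P.ρ * (c / (4 * K))), by positivity, ?_⟩
  filter_upwards [hga (1 / 2) (by norm_num), hga (c / (8 * C)) (by positivity)] with k hk1 hk2
  rw [hrun.τ_eq, ha, mul_one]
  rcases Nat.eq_zero_or_eq_succ_pred (h k) with h0 | h0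
  · rw [h0, pow_zero]; exact min_le_left _ _
  refine (min_le_right _ _).trans ?_
  set i := (h k).pred
  rw [h0, pow_succ, mul_comm (P.ρ ^ i)]
  refine mul_le_mul_of_nonneg_left ?_ hρ.le
  have hfail : ¬ _ := fun hmem => absurd ((hrun.h_least k).2 hmem) (by omega : ¬ h k ≤ i)
  rw [Set.mem_ofPred_eq, not_le, ha, mul_one] at hfail
  set t := P.ρ ^ i with ht
  have ht0 : 0 < t := by positivity
  set γ := approxGrad φ lam pa (x k) (ε k) with hγ
  have hd0 : 0 < ‖d k‖ := norm_pos_iff.2 (hrun.d_ne_zero k)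
  obtain ⟨hq, hCd⟩ := hdir k
  set q := -inner ℝ γ (d k) with hqdef
  have hq0 : 0 ≤ q := le_trans (by positivity) hq
  have hδγ : P.gam γ (d k) ≤ 1 / 2 := (min_le_left _ _).trans hδ.le
  have h1 := hpa (x k + t • d k) (ε (k + 1)) (hrun.ε_pos _)
  have h2 := hup (x k) (x k + t • d k)
  rw [add_sub_cancel_left, inner_smul_right, norm_smul, Real.norm_of_nonneg ht0.le, mul_pow] at h2
  have h3 : F (x k) ≤ windowMax (fun j => approxVal f φ lam pa (x j) (ε j)) k (m k) :=
    (hlo (x k) (ε k) (hrun.ε_pos k)).trans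
      (le_windowMax (fun j => approxVal f φ lam pa (x j) (ε j)) k (Nat.zero_le (m k)))
  have h4 := hrun.ε_succ k
  have h5 := hrun.ε_pos k
  have h6 : inner ℝ (g (x k)) (d k) ≤ -(3 / 4 * q) := by
    have e1 : ‖g (x k)‖ ≤ 2 * ‖γ‖ := by
      have := norm_sub_norm_le (g (x k)) γ
      rw [norm_sub_rev] at this
      linarith
    have e2 : ‖γ - g (x k)‖ ≤ c / 4 * ‖d k‖ := by
      calc ‖γ - g (x k)‖ ≤ c / (8 * C) * ‖g (x k)‖ := hk2
        _ ≤ c / (8 * C) * (2 * (C * ‖d k‖)) := by gcongr; linarith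
        _ = c / 4 * ‖d k‖ := by field_simp; ring
    have e3 := real_inner_le_norm (g (x k) - γ) (d k)
    rw [inner_sub_left, norm_sub_rev] at e3
    nlinarith [mul_le_mul_of_nonneg_right e2 hd0.le]
  have h7 : t * (P.gam γ (d k) * q) ≤ t * (1 / 2 * q) := by gcongr
  have h8 : t * inner ℝ (g (x k)) (d k) ≤ t * -(3 / 4 * q) := by gcongr
  have e9 : inner ℝ γ (d k) = -q := by rw [hqdef, neg_neg]
  rw [e9] at hfail
  have h9 : t * (1 / 4 * q) ≤ t * (K * t * ‖d k‖ ^ 2) := by nlinarith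
  have h10 := le_of_mul_le_mul_left h9 ht0
  have h11 : c * ‖d k‖ ^ 2 ≤ (t * (4 * K)) * ‖d k‖ ^ 2 := by nlinarith
  rw [div_le_iff₀ (by positivity)]
  exact le_of_mul_le_mul_right h11 (by positivity)

theorem IsRun.tendsto_gradient (hrun : IsRun f φ lam pa P x d V α ε m h τ) (hK : 0 < K)
    (hδ : P.δ < 1 / 2) (ha : P.a = 1)
    (hup : ∀ x y, F y ≤ F x + inner ℝ (g x) (y - x) + K * ‖y - x‖ ^ 2)
    (hlip : ∀ x y, ‖g x - g y‖ ≤ K * ‖x - y‖)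
    {xbar : Rn n} (hmin : ∀ y, F xbar ≤ F y)
    (hlo : ∀ y e, 0 < e → F y ≤ approxVal f φ lam pa y e)
    (hpa : ∀ y e, 0 < e → approxVal f φ lam pa y e ≤ F y + e)
    {c C b : ℝ} (hc : 0 < c) (hC : 0 < C) (hb : 0 < b)
    (hdir : ∀ k, c * ‖d k‖ ^ 2 ≤ -inner ℝ (approxGrad φ lam pa (x k) (ε k)) (d k) ∧
        ‖approxGrad φ lam pa (x k) (ε k)‖ ≤ C * ‖d k‖)
    (hgab : ∀ k, ‖approxGrad φ lam pa (x k) (ε k) - g (x k)‖ ≤ b * Real.sqrt (ε k))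
    (hε : ε =o[atTop] fun k => ‖g (x k)‖ ^ 2) :
    Tendsto (fun k => ‖g (x k)‖) atTop (𝓝 0) := by
  have hga : ∀ η > 0, ∀ᶠ k in atTop,
      ‖approxGrad φ lam pa (x k) (ε k) - g (x k)‖ ≤ η * ‖g (x k)‖ :=
    fun η hη => eventually_norm_sub_le_of_isLittleO hb hgab hε hη
  obtain ⟨τ₀, hτ₀, hτ⟩ := hrun.eventually_le_τ hK hδ ha hup hlo hpa hc hC hdir hga
  set γ : ℕ → Rn n := fun k => approxGrad φ lam pa (x k) (ε k) with hγ
  set Φ : ℕ → ℝ := fun j => approxVal f φ lam pa (x j) (ε j) + 2 * ε j with hΦ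
  set s : ℕ → ℝ := fun k => P.gam (γ k) (d k) * τ k * -inner ℝ (γ k) (d k) with hs
  have hq0 : ∀ k, 0 ≤ -inner ℝ (γ k) (d k) := fun k => le_trans (by positivity) (hdir k).1
  have hs0 : ∀ k, 0 ≤ s k := fun k =>
    mul_nonneg (mul_nonneg (P.gam_nonneg (hq0 k)) (hrun.τ_pos k).le) (hq0 k)
  have hstep : ∀ k, Φ (k + 1) ≤ windowMax Φ k (m k) - s k := hrun.nonmonotone_step
  have hFΦ : ∀ k, F (x k) ≤ Φ k := fun k => by
    have h1 := hlo (x k) (ε k) (hrun.ε_pos k)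
    have h2 := hrun.ε_pos k
    simp only [hΦ]
    linarith
  -- Bounded values of `F` bound the gradients, without compact level sets. The `+ 1` makes the
  -- bound positive, so that `ψ` is positive there.
  have hbd : ∀ k, ‖γ k‖ ≤ Real.sqrt (4 * K * (Φ 0 - F xbar)) + b * Real.sqrt (ε 0) + 1 := by
    intro k
    have h1 : ‖g (x k)‖ ≤ Real.sqrt (4 * K * (Φ 0 - F xbar)) := by
      refine Real.le_sqrt_of_sq_le ((sq_norm_gradient_le hK hup hmin (x k)).trans ?_)
      have := hFΦ k
      have := le_first_of_nonmonotone hrun.m_succ hs0 hstep k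
      gcongr
      linarith
    have h2 : ‖γ k - g (x k)‖ ≤ b * Real.sqrt (ε 0) :=
      (hgab k).trans (by gcongr; exact hrun.ε_antitone (Nat.zero_le k))
    have h3 := norm_sub_norm_le (γ k) (g (x k))
    linarith
  set β := Real.sqrt (4 * K * (Φ 0 - F xbar)) + b * Real.sqrt (ε 0) + 1 with hβ
  have hβ0 : 0 < β := by positivity
  set γ₀ := min P.δ (P.ψ β) with hγ₀
  have hγ₀pos : 0 < γ₀ := lt_min P.δ_pos (P.ψ_pos β hβ0)
  have hcmp : ∀ᶠ k in atTop, ‖g (x k)‖ ≤ 2 * ‖γ k‖ ∧ ‖γ k‖ ≤ 2 * ‖g (x k)‖ := by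
    filter_upwards [hga (1 / 2) (by norm_num)] with k hk
    have h1 := norm_sub_norm_le (g (x k)) (γ k)
    rw [norm_sub_rev] at h1
    have h2 := norm_sub_norm_le (γ k) (g (x k))
    have := norm_nonneg (g (x k))
    constructor <;> linarith
  have hslow : ∀ᶠ k in atTop, γ₀ * τ₀ * (c / (4 * C ^ 2)) * ‖g (x k)‖ ^ 2 ≤ s k := by
    filter_upwards [hτ, hcmp] with k hk1 hk2
    have h1 : c / (4 * C ^ 2) * ‖g (x k)‖ ^ 2 ≤ -inner ℝ (γ k) (d k) := by
      refine le_trans ?_ (hdir k).1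
      have h2 : ‖g (x k)‖ ≤ 2 * (C * ‖d k‖) := hk2.1.trans (by gcongr; exact (hdir k).2)
      calc c / (4 * C ^ 2) * ‖g (x k)‖ ^ 2 ≤ c / (4 * C ^ 2) * (2 * (C * ‖d k‖)) ^ 2 := by gcongr
        _ = c * ‖d k‖ ^ 2 := by field_simp; ring
    have h2 : γ₀ ≤ P.gam (γ k) (d k) := P.le_gam (hq0 k) (hbd k)
    have h3 : γ₀ * τ₀ ≤ P.gam (γ k) (d k) * τ k :=
      mul_le_mul h2 hk1 hτ₀.le (P.gam_nonneg (hq0 k))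
    rw [mul_assoc]
    exact mul_le_mul h3 h1 (by positivity) (by
      exact mul_nonneg (P.gam_nonneg (hq0 k)) (hrun.τ_pos k).le)
  refine tendsto_zero_of_window (M := P.M) (Q := 1 + K * (2 / c)) (fun k => norm_nonneg _)
    (by have : 0 ≤ K * (2 / c) := by positivity
        linarith) ?_ ?_
  · filter_upwards [hcmp] with k hk
    have h1 : ‖g (x (k + 1))‖ ≤ ‖g (x k)‖ + K * ‖x (k + 1) - x k‖ := by
      have := norm_sub_norm_le (g (x (k + 1))) (g (x k))
      linarith [hlip (x (k + 1)) (x k)]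
    have h2 : ‖x (k + 1) - x k‖ ≤ ‖d k‖ := by
      rw [hrun.x_succ, add_sub_cancel_left, norm_smul, Real.norm_of_nonneg (hrun.τ_pos k).le]
      exact mul_le_of_le_one_left (norm_nonneg _) (hrun.τ_le_one ha k)
    have h3 : c * ‖d k‖ ≤ ‖γ k‖ := by
      have h4 := real_inner_le_norm (γ k) (-d k)
      rw [inner_neg_right, norm_neg] at h4
      have h5 := (hdir k).1.trans h4
      rw [pow_two, ← mul_assoc] at h5
      exact le_of_mul_le_mul_right h5 (norm_pos_iff.2 (hrun.d_ne_zero k))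
    have h4 : ‖d k‖ ≤ 2 / c * ‖g (x k)‖ := by
      rw [div_mul_eq_mul_div, le_div_iff₀ hc]
      linarith [hk.2]
    calc ‖g (x (k + 1))‖ ≤ ‖g (x k)‖ + K * (2 / c * ‖g (x k)‖) :=
          h1.trans (by gcongr; exact h2.trans h4)
      _ = _ := by ring
  · intro η hη
    obtain ⟨N, hN⟩ := eventually_atTop.1 hslow
    have hwin := eventually_exists_lt_of_nonmonotone hrun.m_succ hs0 hstep
      (fun k => (hmin (x k)).trans (hFΦ k))
      (by positivity : 0 < γ₀ * τ₀ * (c / (4 * C ^ 2)) * η ^ 2)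
    filter_upwards [hwin, eventually_ge_atTop N] with k hk hkN
    obtain ⟨j, hj1, hj2, hj⟩ := hk
    refine ⟨j, hj1, hj2, ?_⟩
    have h1 := (hN j (hkN.trans hj1)).trans_lt hj
    have h2 := lt_of_mul_lt_mul_left h1 (by positivity)
    exact lt_of_pow_lt_pow_left₀ 2 hη.le h2

end Run

/-! ### The limit derivative at the minimizer. -/

section Local

variable {n : ℕ} {F : Rn n → ℝ} {g : Rn n → Rn n} {K : ℝ}

/-- If the derivative is Lipschitz near a sequence converging to `xbar`, then along the points of
differentiability it has a limit at `xbar`. -/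
theorem DerivLipschitzNear.exists_limit {C : NNReal} (hlip : LipschitzWith C g) {x : ℕ → Rn n}
    {xbar : Rn n} (hL : DerivLipschitzNear g x) (hx : Tendsto x atTop (𝓝 xbar)) :
    ∃ B ∈ bSubdiff g xbar, ∀ η > 0, ∃ r > 0, ∀ u ∈ Metric.ball xbar r,
      DifferentiableAt ℝ g u → ‖fderiv ℝ g u - B‖ ≤ η := by
  obtain ⟨r, l, hr, hev⟩ := hL
  obtain ⟨B, hB⟩ := bSubdiff_nonempty hlip xbar
  refine ⟨B, hB, fun η hη => ?_⟩
  obtain ⟨k, hk, hkx⟩ := (hev.and (hx.eventually (Metric.ball_mem_nhds xbar (half_pos hr)))).exists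
  have hsub : ∀ u ∈ Metric.ball xbar (r / 2), u ∈ Metric.ball (x k) r := by
    intro u hu
    rw [Metric.mem_ball] at *
    have := dist_triangle_right u (x k) xbar
    linarith
  obtain ⟨u, hud, hux, huB⟩ := hB
  refine ⟨min (r / 2) (η / (|l| + 1)), by positivity, fun w hw hwd => ?_⟩
  have hw1 : w ∈ Metric.ball xbar (r / 2) := Metric.ball_subset_ball (min_le_left _ _) hw
  have hlim1 : Tendsto (fun i => ‖fderiv ℝ g w - fderiv ℝ g (u i)‖) atTop
      (𝓝 ‖fderiv ℝ g w - B‖) := (tendsto_const_nhds.sub huB).norm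
  have hlim2 : Tendsto (fun i => l * ‖w - u i‖) atTop (𝓝 (l * ‖w - xbar‖)) :=
    (tendsto_const_nhds.sub hux).norm.const_mul l
  have hle : ‖fderiv ℝ g w - B‖ ≤ l * ‖w - xbar‖ := by
    refine le_of_tendsto_of_tendsto hlim1 hlim2 ?_
    filter_upwards [hux.eventually (Metric.ball_mem_nhds xbar (half_pos hr))] with i hi
    exact hk w (hsub w hw1) (u i) (hsub _ hi) hwd (hud i)
  have hw2 : ‖w - xbar‖ ≤ η / (|l| + 1) :=
    (mem_ball_iff_norm.1 hw).le.trans (min_le_right _ _)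
  calc ‖fderiv ℝ g w - B‖ ≤ l * ‖w - xbar‖ := hle
    _ ≤ (|l| + 1) * (η / (|l| + 1)) := by
      gcongr
      linarith [le_abs_self l]
    _ = η := by field_simp

theorem norm_sub_le_of_mem_bSubdiff {B A : Rn n →L[ℝ] Rn n} {xbar y : Rn n} {r η : ℝ}
    (h : ∀ u ∈ Metric.ball xbar r, DifferentiableAt ℝ g u → ‖fderiv ℝ g u - B‖ ≤ η)
    (hy : y ∈ Metric.ball xbar r) (hA : A ∈ bSubdiff g y) : ‖A - B‖ ≤ η := by
  obtain ⟨u, hud, huy, huA⟩ := hA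
  refine le_of_tendsto (huA.sub_const B).norm ?_
  filter_upwards [huy.eventually (Metric.isOpen_ball.mem_nhds hy)] with i hi
  exact h _ hi (hud i)

theorem quadratic_expansion (hF : ∀ x, HasGradientAt F (g x) x) {xbar : Rn n}
    {B : Rn n →L[ℝ] Rn n} {r η : ℝ}
    (h : ∀ y ∈ Metric.ball xbar r, ‖g y - B (y - xbar)‖ ≤ η * ‖y - xbar‖)
    {y : Rn n} (hy : y ∈ Metric.ball xbar r) :
    |F y - F xbar - 1 / 2 * inner ℝ (B (y - xbar)) (y - xbar)| ≤ η * ‖y - xbar‖ ^ 2 := by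
  set e := y - xbar with he
  have hη : 0 ≤ η * ‖e‖ := (norm_nonneg _).trans (h y hy)
  set Q := inner ℝ (B e) e with hQ
  have hder : ∀ t : ℝ, HasDerivAt (fun t : ℝ => F (xbar + t • e) - t ^ 2 / 2 * Q)
      (inner ℝ (g (xbar + t • e)) e - t * Q) t := by
    intro t
    have h1 : HasDerivAt (fun t : ℝ => xbar + t • e) e t := by
      simpa using ((hasDerivAt_id t).smul_const e).const_add xbar
    have h2 := (hF (xbar + t • e)).hasFDerivAt.comp_hasDerivAt t h1
    have h3 : HasDerivAt (fun t : ℝ => t ^ 2 / 2 * Q) (t * Q) t := by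
      have := (((hasDerivAt_id t).pow 2).div_const 2).mul_const Q
      simpa using this
    have h4 := h2.sub h3
    simp only [InnerProductSpace.toDual_apply_apply] at h4
    exact h4
  have key := norm_image_sub_le_of_norm_deriv_le_segment_01'
    (f := fun t : ℝ => F (xbar + t • e) - t ^ 2 / 2 * Q) (C := η * ‖e‖ ^ 2)
    (fun t _ => (hder t).hasDerivWithinAt) (by
      intro t ht
      have hn : ‖t • e‖ ≤ ‖e‖ := by
        rw [norm_smul, Real.norm_of_nonneg ht.1]
        exact mul_le_of_le_one_left (norm_nonneg _) ht.2.le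
      have hm : xbar + t • e ∈ Metric.ball xbar r := by
        rw [mem_ball_iff_norm] at hy ⊢
        rw [add_sub_cancel_left]
        exact hn.trans_lt hy
      have h1 := h _ hm
      rw [add_sub_cancel_left, norm_smul, Real.norm_of_nonneg ht.1] at h1
      have h2 : inner ℝ (g (xbar + t • e)) e - t * Q
          = inner ℝ (g (xbar + t • e) - B (t • e)) e := by
        rw [inner_sub_left, map_smul, real_inner_smul_left]
      rw [h2, Real.norm_eq_abs]
      refine (abs_real_inner_le_norm _ _).trans ?_
      have h3 : η * (t * ‖e‖) ≤ η * ‖e‖ := by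
        nlinarith [mul_nonneg hη (sub_nonneg.2 ht.2.le)]
      calc _ ≤ (η * ‖e‖) * ‖e‖ := mul_le_mul_of_nonneg_right (h1.trans h3) (norm_nonneg _)
        _ = _ := by ring)
  have hxy : xbar + e = y := by rw [he]; abel
  simp only [one_smul, zero_smul, add_zero, hxy, Real.norm_eq_abs] at key
  convert key using 2
  ring

end Local

/-! ### Unit steps and superlinear convergence. -/

section Newton

variable {n : ℕ} {f : Rn n → ℝ} {φ : Rn n → Rn n → ℝ} {lam : ℝ} {pa : Rn n → ℝ → Rn n}
  {P : GAParams} {x d : ℕ → Rn n} {V : ℕ → (Rn n →L[ℝ] Rn n)} {α ε : ℕ → ℝ} {m h : ℕ → ℕ}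
  {τ : ℕ → ℝ} {F : Rn n → ℝ} {g : Rn n → Rn n} {K : ℝ}

theorem eventually_norm_sub_le_of_infDist {C : NNReal} (hlip : LipschitzWith C g)
    {xbar : Rn n} (hx : Tendsto x atTop (𝓝 xbar)) {B : Rn n →L[ℝ] Rn n}
    (hB : ∀ η > 0, ∃ r > 0, ∀ u ∈ Metric.ball xbar r,
      DifferentiableAt ℝ g u → ‖fderiv ℝ g u - B‖ ≤ η)
    (hV : Tendsto (fun k => Metric.infDist (V k) (bSubdiff g (x k))) atTop (𝓝 0))
    (hα : Tendsto α atTop (𝓝 0)) {η : ℝ} (hη : 0 < η) :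
    ∀ᶠ k in atTop, ‖V k + α k • ContinuousLinearMap.id ℝ (Rn n) - B‖ ≤ η := by
  obtain ⟨r, hr, hball⟩ := hB (η / 3) (by positivity)
  filter_upwards [hV.eventually_lt_const (by positivity : 0 < η / 3),
    hα.abs.eventually_lt_const (by simpa using by positivity : |(0 : ℝ)| < η / 3),
    hx.eventually (Metric.ball_mem_nhds xbar hr)] with k hk1 hk2 hk3
  -- Nonemptiness matters: `infDist` to the empty set is `0` by default.
  obtain ⟨A, hA, hVA⟩ := (Metric.infDist_lt_iff (bSubdiff_nonempty hlip (x k))).1 hk1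
  have h1 := norm_sub_le_of_mem_bSubdiff hball hk3 hA
  rw [dist_eq_norm] at hVA
  have h2 : ‖α k • ContinuousLinearMap.id ℝ (Rn n)‖ ≤ |α k| := by
    rw [norm_smul, Real.norm_eq_abs]
    exact mul_le_of_le_one_right (abs_nonneg _) ContinuousLinearMap.norm_id_le
  have e : V k + α k • ContinuousLinearMap.id ℝ (Rn n) - B
      = (V k - A) + (A - B) + α k • ContinuousLinearMap.id ℝ (Rn n) := by abel
  rw [e]
  have h3 := norm_add₃_le (a := V k - A) (b := A - B)
    (c := α k • ContinuousLinearMap.id ℝ (Rn n))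
  linarith

/-- A single quasi-Newton step: if `T d = -γ` with `T` close to `B` and `γ` close to `B e`, then
`e + d` is small. -/
theorem norm_add_le_of_newton {E : Type*} [NormedAddCommGroup E] [NormedSpace ℝ E]
    {T B : E →L[ℝ] E} {e d γ : E} {c η D : ℝ}
    (hT : ∀ v, c * ‖v‖ ≤ ‖T v‖) (hd : T d = -γ) (hTB : ‖T - B‖ ≤ η) (hγ : ‖γ - B e‖ ≤ D * ‖e‖) :
    c * ‖e + d‖ ≤ (η + D) * ‖e‖ := by
  have h1 : T (e + d) = (T - B) e - (γ - B e) := by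
    rw [map_add, hd, sub_apply]; abel
  have h2 := (T - B).le_of_opNorm_le hTB e
  calc c * ‖e + d‖ ≤ ‖T (e + d)‖ := hT _
    _ ≤ ‖(T - B) e‖ + ‖γ - B e‖ := by rw [h1]; exact norm_sub_le _ _
    _ ≤ η * ‖e‖ + D * ‖e‖ := add_le_add h2 hγ
    _ = _ := by ring

/-- Since `d ≈ -e` and `γ ≈ B e`, the predicted slope is close to `⟨B e, e⟩`. -/
theorem neg_inner_le_of_newton {E : Type*} [NormedAddCommGroup E] [InnerProductSpace ℝ E]
    {B : E →L[ℝ] E} {e d γ : E} {η : ℝ} (hη : 0 ≤ η) (hη1 : η ≤ 1)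
    (hd : ‖e + d‖ ≤ η * ‖e‖) (hγ : ‖γ - B e‖ ≤ η * ‖e‖) :
    -inner ℝ γ d ≤ inner ℝ (B e) e + η * (‖B‖ + 2) * ‖e‖ ^ 2 := by
  have h1 : -inner ℝ γ d = inner ℝ (B e) e + inner ℝ (γ - B e) e - inner ℝ (γ - B e) (e + d)
      - inner ℝ (B e) (e + d) := by
    simp only [inner_sub_left, inner_add_right]; ring
  have h2 := (real_inner_le_norm (γ - B e) e).trans
    (mul_le_mul_of_nonneg_right hγ (norm_nonneg e))
  have h3 := (abs_le.1 (abs_real_inner_le_norm (γ - B e) (e + d))).1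
  have h4 := (abs_le.1 (abs_real_inner_le_norm (B e) (e + d))).1
  have h5 : ‖γ - B e‖ * ‖e + d‖ ≤ (η * ‖e‖) * ‖e‖ := by
    refine mul_le_mul hγ (hd.trans ?_) (norm_nonneg _) (by positivity)
    exact mul_le_of_le_one_left (norm_nonneg e) hη1
  have h6 : ‖B e‖ * ‖e + d‖ ≤ (‖B‖ * ‖e‖) * (η * ‖e‖) :=
    mul_le_mul (B.le_opNorm e) hd (norm_nonneg _) (by positivity)
  rw [h1]
  nlinarith

theorem IsRun.τ_eq_one_of_test (hrun : IsRun f φ lam pa P x d V α ε m h τ) (ha : P.a = 1)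
    (hlo : ∀ y e, 0 < e → F y ≤ approxVal f φ lam pa y e)
    (hpa : ∀ y e, 0 < e → approxVal f φ lam pa y e ≤ F y + e) {k : ℕ}
    (hq : 0 ≤ -inner ℝ (approxGrad φ lam pa (x k) (ε k)) (d k))
    (htest : F (x k + d k) ≤ F (x k)
      + P.δ * inner ℝ (approxGrad φ lam pa (x k) (ε k)) (d k)) : τ k = 1 := by
  have hmem : h k ≤ 0 := (hrun.h_least k).2 (by
    rw [Set.mem_ofPred_eq, ha, pow_zero, one_mul, one_smul, mul_one]
    have h1 := hpa (x k + d k) (ε (k + 1)) (hrun.ε_pos _)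
    have h2 : F (x k) ≤ windowMax (fun j => approxVal f φ lam pa (x j) (ε j)) k (m k) :=
      (hlo (x k) (ε k) (hrun.ε_pos k)).trans
        (le_windowMax (fun j => approxVal f φ lam pa (x j) (ε j)) k (Nat.zero_le (m k)))
    have h3 := hrun.ε_succ k
    have h4 := hrun.ε_pos k
    have h5 : P.gam (approxGrad φ lam pa (x k) (ε k)) (d k) ≤ P.δ := min_le_left _ _
    nlinarith [mul_le_mul_of_nonneg_right h5 hq])
  rw [hrun.τ_eq, ha, Nat.le_zero.1 hmem, pow_zero, one_mul]

theorem IsRun.eventually_unit_step (hrun : IsRun f φ lam pa P x d V α ε m h τ) (hK : 0 < K)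
    (hδ : P.δ < 1 / 2) (ha : P.a = 1)
    (hF : ∀ x, HasGradientAt F (g x) x)
    (hup : ∀ x y, F y ≤ F x + inner ℝ (g x) (y - x) + K * ‖y - x‖ ^ 2)
    {C : NNReal} (hlip : LipschitzWith C g)
    {xbar : Rn n} (h0 : g xbar = 0)
    (hlo : ∀ y e, 0 < e → F y ≤ approxVal f φ lam pa y e)
    (hpa : ∀ y e, 0 < e → approxVal f φ lam pa y e ≤ F y + e)
    {c : ℝ} (hc : 0 < c)
    (hinv : ∀ k v, c * ‖v‖ ≤ ‖(V k + α k • ContinuousLinearMap.id ℝ (Rn n)) v‖)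
    (hq : ∀ k, 0 ≤ -inner ℝ (approxGrad φ lam pa (x k) (ε k)) (d k))
    (hga : ∀ η > 0, ∀ᶠ k in atTop,
      ‖approxGrad φ lam pa (x k) (ε k) - g (x k)‖ ≤ η * ‖g (x k)‖)
    (hx : Tendsto x atTop (𝓝 xbar)) {B : Rn n →L[ℝ] Rn n}
    (hB : ∀ η > 0, ∃ r > 0, ∀ u ∈ Metric.ball xbar r,
      DifferentiableAt ℝ g u → ‖fderiv ℝ g u - B‖ ≤ η)
    {μ : ℝ} (hμ : 0 < μ) (hpd : ∀ v, μ * ‖v‖ ^ 2 ≤ inner ℝ (B v) v)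
    (hV : Tendsto (fun k => Metric.infDist (V k) (bSubdiff g (x k))) atTop (𝓝 0))
    (hα : Tendsto α atTop (𝓝 0)) {η : ℝ} (hη : 0 < η) :
    ∀ᶠ k in atTop, τ k = 1 ∧ ‖x (k + 1) - xbar‖ ≤ η * ‖x k - xbar‖ := by
  -- The summands collect the errors of `F (x k + d k)`, of the expansion of `F (x k)`, and of the
  -- slope. The choice of `s` keeps their total below `(1 / 2 - δ) μ ‖e‖²`.
  set D : ℝ := K + 1 + (‖B‖ + 2) with hD
  have hD0 : 0 < D := by positivity
  set s : ℝ := min (min η 1) ((1 / 2 - P.δ) * μ / D) with hs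
  have hδ' : 0 < 1 / 2 - P.δ := by linarith
  have hs0 : 0 < s := by positivity
  have hsη : s ≤ η := (min_le_left _ _).trans (min_le_left _ _)
  have hs1 : s ≤ 1 := (min_le_left _ _).trans (min_le_right _ _)
  have hsD : s * D ≤ (1 / 2 - P.δ) * μ := (le_div_iff₀ hD0).1 (min_le_right _ _)
  -- One third of `c * s` pays for the matrix error and two thirds for the gradient error `2 * s'`.
  set s' : ℝ := min (s / 2) (c * s / 3) with hs'
  have hs'0 : 0 < s' := by positivity
  obtain ⟨r, hr, hball⟩ := hB s' hs'0
  have hg : ∀ y ∈ Metric.ball xbar r, ‖g y - B (y - xbar)‖ ≤ s' * ‖y - xbar‖ := by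
    intro y hy
    have := hlip.norm_sub_sub_le_of_fderiv_near Metric.isOpen_ball (convex_ball xbar r) hball hy
      (Metric.mem_ball_self hr)
    rwa [h0, sub_zero] at this
  have hC : (0 : ℝ) < C + 1 := by positivity
  filter_upwards [hx.eventually (Metric.ball_mem_nhds xbar hr),
    eventually_norm_sub_le_of_infDist hlip hx hB hV hα (by positivity : 0 < c * s / 3),
    hga (s' / (C + 1)) (by positivity)] with k hk1 hk2 hk3
  set γ := approxGrad φ lam pa (x k) (ε k) with hγ
  set e := x k - xbar with he
  have hgx : ‖g (x k)‖ ≤ (C + 1) * ‖e‖ := by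
    have h1 := hlip.dist_le_mul (x k) xbar
    rw [h0, dist_zero_right, dist_eq_norm] at h1
    linarith [norm_nonneg e]
  have hγg : ‖γ - g (x k)‖ ≤ s' * ‖e‖ := by
    calc ‖γ - g (x k)‖ ≤ s' / (C + 1) * ‖g (x k)‖ := hk3
      _ ≤ s' / (C + 1) * ((C + 1) * ‖e‖) := by gcongr
      _ = s' * ‖e‖ := by field_simp
  have hγB : ‖γ - B e‖ ≤ 2 * s' * ‖e‖ := by
    have h1 := norm_sub_le_norm_sub_add_norm_sub γ (g (x k)) (B e)
    have h2 := hg (x k) hk1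
    linarith
  have hs'1 : 2 * s' ≤ s := by
    have : s' ≤ s / 2 := min_le_left _ _
    linarith
  have hs'2 : s' ≤ c * s / 3 := min_le_right _ _
  have hed : ‖e + d k‖ ≤ s * ‖e‖ := by
    have h1 := norm_add_le_of_newton (hinv k) (hrun.direction k) hk2 hγB
    have h2 : (c * s / 3 + 2 * s') * ‖e‖ ≤ (c * s) * ‖e‖ := by gcongr; linarith
    rw [mul_assoc] at h2
    exact le_of_mul_le_mul_left (h1.trans h2) hc
  have hxd : x k + d k - xbar = e + d k := by rw [he]; abel
  have hτ : τ k = 1 := by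
    refine hrun.τ_eq_one_of_test ha hlo hpa (hq k) ?_
    have h1 := hup xbar (x k + d k)
    rw [h0, inner_zero_left, add_zero, hxd] at h1
    have h2 : K * ‖e + d k‖ ^ 2 ≤ K * s * ‖e‖ ^ 2 := by
      have h3 : ‖e + d k‖ ^ 2 ≤ (s * ‖e‖) ^ 2 := by gcongr
      have h4 : (s * ‖e‖) ^ 2 ≤ s * ‖e‖ ^ 2 := by
        rw [mul_pow]
        gcongr
        nlinarith
      rw [mul_assoc]
      exact mul_le_mul_of_nonneg_left (h3.trans h4) hK.le
    have h3 := (abs_le.1 (quadratic_expansion hF hg hk1)).1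
    rw [← he] at h3
    have h4 := neg_inner_le_of_newton hs0.le hs1 hed
      (hγB.trans (mul_le_mul_of_nonneg_right hs'1 (norm_nonneg e)))
    have h5 := mul_le_mul_of_nonneg_left h4 P.δ_pos.le
    have h6 := mul_le_mul_of_nonneg_left (hpd e) hδ'.le
    have h7 := mul_le_mul_of_nonneg_right hsD (sq_nonneg ‖e‖)
    have h8 : s' * ‖e‖ ^ 2 ≤ s * ‖e‖ ^ 2 := by gcongr; linarith
    have h9 : P.δ * (s * (‖B‖ + 2) * ‖e‖ ^ 2) ≤ s * (‖B‖ + 2) * ‖e‖ ^ 2 :=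
      mul_le_of_le_one_left (by positivity) (by linarith)
    have h10 : s * D * ‖e‖ ^ 2
        = K * s * ‖e‖ ^ 2 + s * ‖e‖ ^ 2 + s * (‖B‖ + 2) * ‖e‖ ^ 2 := by rw [hD]; ring
    linarith
  refine ⟨hτ, ?_⟩
  rw [hrun.x_succ, hτ, one_smul, hxd]
  exact hed.trans (by gcongr)

end Newton

theorem theorem4 {n : ℕ} (f : Rn n → ℝ) (hf : ConvexOn ℝ Set.univ f)
    (φ : Rn n → Rn n → ℝ) (hφ : IsPhiRegular φ) (lam : ℝ) (hlam : 0 < lam)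
    (pa : Rn n → ℝ → Rn n) (hpa : IsApproxProx f φ lam pa)
    (P : GAParams) (hδ : P.δ < 1 / 2) (ha : P.a = 1)
    (x d : ℕ → Rn n) (V : ℕ → (Rn n →L[ℝ] Rn n)) (α ε : ℕ → ℝ) (m h : ℕ → ℕ) (τ : ℕ → ℝ)
    (hrun : IsRun f φ lam pa P x d V α ε m h τ)
    (heig : EigenvaluesUnifBdd (fun k => V k + α k • ContinuousLinearMap.id ℝ (Rn n)))
    (xbar : Rn n) (hmin : ∀ y, f xbar ≤ f y)
    (hBD : IsBDRegular (phiGrad f φ lam) xbar)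
    (hε : ε =o[atTop] (fun k => ‖phiGrad f φ lam (x k)‖ ^ 2))
    (hV : Tendsto (fun k => Metric.infDist (V k) (bSubdiff (phiGrad f φ lam) (x k))) atTop (𝓝 0))
    (hα : Tendsto α atTop (𝓝 0))
    (hLip : DerivLipschitzNear (phiGrad f φ lam) x) :
    (∀ y, (∀ z, f y ≤ f z) → y = xbar) ∧
    (∀ᶠ k in atTop, τ k = 1) ∧
    ConvergesTwoStepQSuperlinearly x xbar := by
  obtain ⟨K, b, hK, hb, hF, hsub, hup, hlipK, happ⟩ := phiReg_facts hf hφ hlam hmin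
  have h0 := phiGrad_eq_zero hφ hlam hmin
  have hFmin := phiReg_min hφ hlam hmin
  have hlo : ∀ y e, 0 < e → phiReg f φ lam y ≤ approxVal f φ lam pa y e :=
    fun y e _ => phiReg_le hφ hlam hmin y (pa y e)
  set F := phiReg f φ lam
  set g := phiGrad f φ lam
  obtain ⟨⟨C, hlip⟩, hBD⟩ := hBD
  have hmono : ∀ x y, 0 ≤ inner ℝ (g x - g y) (x - y) := by
    intro x y
    have h1 := hsub x y
    have h2 := hsub y x
    rw [← neg_sub x y, inner_neg_right] at h1
    rw [inner_sub_left]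
    linarith
  obtain ⟨μ, hμ, hpd, herr⟩ := exists_error_bound hF hmono hlip hBD h0
  obtain ⟨c, C', hc, hC', hinv, hdir⟩ := hrun.direction_bounds heig
  have hgab : ∀ k, ‖approxGrad φ lam pa (x k) (ε k) - g (x k)‖ ≤ b * Real.sqrt (ε k) :=
    fun k => happ _ _ _ (hrun.ε_pos k) (hpa _ _ (hrun.ε_pos k))
  have hga : ∀ η > 0, ∀ᶠ k in atTop,
      ‖approxGrad φ lam pa (x k) (ε k) - g (x k)‖ ≤ η * ‖g (x k)‖ :=
    fun η hη => eventually_norm_sub_le_of_isLittleO hb hgab hε hη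
  have hgx := hrun.tendsto_gradient hK hδ ha hup hlipK hFmin hlo hpa hc hC' hb hdir hgab hε
  have hx : Tendsto x atTop (𝓝 xbar) := by
    have h1 : Tendsto (fun k => min (μ / 2) ‖x k - xbar‖) atTop (𝓝 0) := by
      have h2 : Tendsto (fun k => ‖g (x k)‖ / μ) atTop (𝓝 0) := by simpa using hgx.div_const μ
      refine squeeze_zero (fun k => by positivity) (fun k => ?_) h2
      rw [le_div_iff₀ hμ, mul_comm]
      exact herr (x k)
    rw [tendsto_iff_norm_sub_tendsto_zero]
    refine h1.congr' ?_
    filter_upwards [h1.eventually_lt_const (half_pos hμ)] with k hk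
    rcases min_lt_iff.1 hk with h3 | h3
    · exact absurd h3 (lt_irrefl _)
    · exact min_eq_right h3.le
  obtain ⟨B, ⟨u, hud, hux, huB⟩, hB⟩ := hLip.exists_limit hlip hx
  have hBpd : ∀ v, μ * ‖v‖ ^ 2 ≤ inner ℝ (B v) v := by
    intro v
    rw [real_inner_comm]
    have h1 : Tendsto (fun k => fderiv ℝ g (u k) v) atTop (𝓝 (B v)) :=
      (isBoundedBilinearMap_apply.continuous.tendsto (B, v)).comp
        (huB.prodMk_nhds tendsto_const_nhds)
    refine ge_of_tendsto (tendsto_const_nhds.inner h1) ?_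
    filter_upwards [hux.eventually (Metric.ball_mem_nhds xbar hμ)] with k hk
    exact hpd _ hk (hud k) v
  -- This is one-step superlinear convergence; the two-step rate uses it with `η` and then with `1`.
  have hstep : ∀ η > 0, ∀ᶠ k in atTop, τ k = 1 ∧ ‖x (k + 1) - xbar‖ ≤ η * ‖x k - xbar‖ :=
    fun η hη => hrun.eventually_unit_step hK hδ ha hF hup hlip h0 hlo hpa hc hinv
      (fun k => le_trans (by positivity) (hdir k).1) hga hx hB hμ hBpd hV hα hη
  refine ⟨fun y hy => ?_, (hstep 1 one_pos).mono fun k hk => hk.1, hx, ?_⟩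
  · have h1 := herr y
    rw [show g y = 0 from phiGrad_eq_zero hφ hlam hy, norm_zero] at h1
    by_contra hne
    have h2 : 0 < ‖y - xbar‖ := norm_pos_iff.2 (sub_ne_zero.2 hne)
    have : 0 < μ * min (μ / 2) ‖y - xbar‖ := by positivity
    linarith
  · refine isLittleO_iff.2 fun η hη => ?_
    filter_upwards [hstep η hη, (tendsto_add_atTop_nat 1).eventually (hstep 1 one_pos)] with k h1 h2
    rw [norm_norm, norm_norm]
    have h3 := h2.2
    rw [one_mul] at h3
    exact h3.trans h1.2
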